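/- Let $X$ be a geodesic metric space, or a connected graph endowed with its standard metric (each edge is an isometric copy of the real unit interval $[0,1]$, and $X$ carries the induced path metric $d$). Let $A,Z\subseteq X$ and let $K>0$ be a real number. A path in $X$ is a continuous map from the interval $[0,1]$ to $X$ (possibly constant), it joins $A$ to $Z$ if it starts in $A$ and ends in $Z$, and the distance between two paths $P_1,P_2$ is $\inf\{d(p,q) : p\in P_1, q\in P_2\}$. Then at least one of the following holds: 1. there is a (possibly empty) set $S\subseteq X$ of diameter at most $K$ such that $X\setminus S$ contains no path joining $A$ to $Z$; 2. there are two paths joining $A$ to $Z$ at distance at least $K/272$ from each other. Moreover, if 1 fails, then for every $x\in A$ and $z\in Z$ the two paths in 2 can be chosen so that both $x$ and $z$ are among their four endpoints. -/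

import Mathlib

/-- Any two points `p`, `q` are joined by a geodesic, that is, by an isometric image of the
real interval `[0, dist p q]`. -/
def IsGeodesicSpace (X : Type*) [MetricSpace X] : Prop :=
  ∀ p q : X, ∃ f : ℝ → X, f 0 = p ∧ f (dist p q) = q ∧
    ∀ s ∈ Set.Icc 0 (dist p q), ∀ t ∈ Set.Icc 0 (dist p q), dist (f s) (f t) = |s - t|

/-- `X` is a connected graph endowed with its standard metric: each edge is an isometric copy of
the real unit interval, and `X` carries the resulting path metric. Here `V` is the set of vertices,
`G` is the adjacency relation on it, and `pt u v s` is the point at distance `s` from `u` on the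
edge `uv` (of relevance only when `u` and `v` are adjacent and `s ∈ [0, 1]`). -/
def IsStandardMetricGraph (X : Type*) [MetricSpace X] : Prop :=
  ∃ (V : Set X) (G : SimpleGraph V) (pt : V → V → ℝ → X),
    G.Connected ∧
    -- every point is a vertex or lies on an edge
    (∀ p : X, p ∈ V ∨ ∃ u v : V, G.Adj u v ∧ ∃ s ∈ Set.Icc (0 : ℝ) 1, p = pt u v s) ∧
    -- the edge `uv` starts at `u`, and `vu` is the same edge traversed backwards
    (∀ u v : V, G.Adj u v → pt u v 0 = u) ∧
    (∀ u v : V, G.Adj u v → ∀ s ∈ Set.Icc (0 : ℝ) 1, pt v u (1 - s) = pt u v s) ∧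
    -- the distance of two vertices is the graph distance
    (∀ u v : V, dist (u : X) (v : X) = G.dist u v) ∧
    -- the distance of two points of the same edge
    (∀ u v : V, G.Adj u v → ∀ s ∈ Set.Icc (0 : ℝ) 1, ∀ t ∈ Set.Icc (0 : ℝ) 1,
      dist (pt u v s) (pt u v t) = |s - t|) ∧
    -- points of two different edges `uv` and `u'v'`: a shortest path leaves the first edge
    -- through `u` or `v` and enters the second one through `u'` or `v'`
    (∀ u v u' v' : V, G.Adj u v → G.Adj u' v' → s(u, v) ≠ s(u', v') →
      ∀ s ∈ Set.Icc (0 : ℝ) 1, ∀ t ∈ Set.Icc (0 : ℝ) 1,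
      dist (pt u v s) (pt u' v' t) =
        min (min (s + G.dist u u' + t) (s + G.dist u v' + (1 - t)))
          (min ((1 - s) + G.dist v u' + t) ((1 - s) + G.dist v v' + (1 - t))))

/-- `S` separates `A` from `Z`: the complement of `S` contains no path (continuous image of the
unit interval, possibly constant) joining a point of `A` to a point of `Z`. -/
def Separates {X : Type*} [TopologicalSpace X] (S A Z : Set X) : Prop :=
  ∀ a ∈ A, ∀ z ∈ Z, ¬ JoinedIn Sᶜ a z

/-- The distance `inf {d(y, z) | y ∈ Y, z ∈ Z}` of two (non-empty) sets. -/
noncomputable def setDist {X : Type*} [MetricSpace X] (Y Z : Set X) : ℝ :=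
  sInf (Set.image2 dist Y Z)

/-! Assume that no set of diameter at most `K` separates, put `ρ = K / 2176`, and let `P` be a
geodesic from `x` to `z`. Paths are replaced by chains of points with gaps below `ρ`; turning two
chains back into paths costs `ρ` of distance (`exists_paths_of_chainIn`), so regions `9 * ρ` apart
give paths `8 * ρ = K / 272` apart. If some chain from `A` to `Z` keeps distance `9 * ρ` from `P`,
that chain and `P` suffice.

Otherwise consider bridges: chain components of the set of points at distance at least `150 * ρ`
from `P`, those meeting `A` being merged with `A` into one bridge, and likewise for `Z`. As the ball
of radius `1088 * ρ` about `P t` does not separate, some bridge touches `P` both far before and far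
after `t` (`exists_crossing`). A greedy argument on the line (`exists_overlapping_chain`) selects
bridges leading from `A` to `Z`, consecutive ones overlapping along `P` and those three steps apart
being well separated. Nearly touching bridges are then linked by short jumps (`exists_bridgeChain`).

Two paths leapfrog along this chain (`BridgeChain.reached_succ`): one is in the current bridge while
the other waits on `P`. If the next bridge is close, the first path jumps to it. Otherwise the
waiting path moves along `P`, in either direction, to the left foot of the next bridge and climbs
it, while the first path descends to the right foot of its bridge and waits there. One path starts
at `x` and one ends at `z`. -/

open Set

/-! ### Chains with small gaps in geodesic spaces. -/

section Chains

variable {X : Type*} [MetricSpace X]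

/-- `p` and `q` are joined by a finite sequence of points of `U` with consecutive distances
less than `ρ`. -/
def ChainIn (ρ : ℝ) (U : Set X) (p q : X) : Prop :=
  p ∈ U ∧ Relation.ReflTransGen (fun a b => b ∈ U ∧ dist a b < ρ) p q

namespace ChainIn

variable {ρ : ℝ} {U V : Set X} {p q s : X}

theorem refl (hp : p ∈ U) : ChainIn ρ U p p := ⟨hp, .refl⟩

theorem mem_left (h : ChainIn ρ U p q) : p ∈ U := h.1

theorem mem_right (h : ChainIn ρ U p q) : q ∈ U := by
  obtain ⟨hp, h⟩ := h
  induction h with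
  | refl => exact hp
  | tail _ h _ => exact h.1

theorem trans (h : ChainIn ρ U p q) (h' : ChainIn ρ U q s) : ChainIn ρ U p s :=
  ⟨h.1, h.2.trans h'.2⟩

theorem single (hp : p ∈ U) (hq : q ∈ U) (h : dist p q < ρ) : ChainIn ρ U p q :=
  ⟨hp, .single ⟨hq, h⟩⟩

theorem symm (h : ChainIn ρ U p q) : ChainIn ρ U q p := by
  obtain ⟨hp, h⟩ := h
  induction h with
  | refl => exact .refl hp
  | tail h₁ h₂ ih =>
    exact (single h₂.1 ih.mem_left (by rw [dist_comm]; exact h₂.2)).trans ih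

theorem mono (h : ChainIn ρ U p q) (hUV : U ⊆ V) : ChainIn ρ V p q :=
  ⟨hUV h.1, Relation.ReflTransGen.mono (fun _ _ h => ⟨hUV h.1, h.2⟩) _ _ h.2⟩

/-- Being joined by a chain is an equivalence relation that holds locally, hence throughout a
preconnected set. -/
theorem of_isPreconnected (hρ : 0 < ρ) (hU : IsPreconnected U) (hp : p ∈ U) (hq : q ∈ U) :
    ChainIn ρ U p q := by
  refine hU.induction₂ (ChainIn ρ U) (fun x hx => ?_) (fun x y z _ _ _ h h' => h.trans h')
    (fun x y _ _ h => h.symm) hp hq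
  filter_upwards [self_mem_nhdsWithin, mem_nhdsWithin_of_mem_nhds (Metric.ball_mem_nhds x hρ)]
    with y hy hy'
  exact single hx hy (by rw [dist_comm]; exact hy')

end ChainIn

theorem continuousOn_of_dist_eq_abs_sub {f : ℝ → X} {s : Set ℝ}
    (hf : ∀ a ∈ s, ∀ b ∈ s, dist (f a) (f b) = |a - b|) : ContinuousOn f s := by
  refine LipschitzOnWith.continuousOn (K := 1) (LipschitzOnWith.of_dist_le_mul ?_)
  intro a ha b hb
  rw [hf a ha b hb, Real.dist_eq]
  simp

/-- The metric interval between two points. -/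
def metricInterval (p q : X) : Set X := {y | dist p y + dist y q = dist p q}

theorem left_mem_metricInterval (p q : X) : p ∈ metricInterval p q := by simp [metricInterval]

theorem IsGeodesicSpace.exists_isPathConnected (hX : IsGeodesicSpace X) (p q : X) :
    ∃ I ⊆ metricInterval p q, IsPathConnected I ∧ p ∈ I ∧ q ∈ I := by
  obtain ⟨f, h0, h1, hf⟩ := hX p q
  have hd : (0 : ℝ) ≤ dist p q := dist_nonneg
  have m0 : (0 : ℝ) ∈ Icc 0 (dist p q) := ⟨le_rfl, hd⟩
  have m1 : dist p q ∈ Icc 0 (dist p q) := ⟨hd, le_rfl⟩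
  refine ⟨f '' Icc 0 (dist p q), ?_, ?_, ⟨0, m0, h0⟩, ⟨_, m1, h1⟩⟩
  · rintro _ ⟨t, ht, rfl⟩
    have e1 := hf 0 m0 t ht
    have e2 := hf t ht _ m1
    rw [h0] at e1
    rw [h1] at e2
    simp only [metricInterval, mem_ofPred_eq]
    rw [e1, e2, abs_of_nonpos (by linarith [ht.1]), abs_of_nonpos (by linarith [ht.2])]
    ring
  · refine ((convex_Icc 0 (dist p q)).isPathConnected ⟨0, m0⟩).image'
      (continuousOn_of_dist_eq_abs_sub hf)

theorem IsGeodesicSpace.exists_mem_metricInterval (hX : IsGeodesicSpace X) (p q : X) {s : ℝ}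
    (h0 : 0 ≤ s) (h1 : s ≤ dist p q) : ∃ y ∈ metricInterval p q, dist p y = s := by
  obtain ⟨f, e0, e1, hf⟩ := hX p q
  have hd : (0 : ℝ) ≤ dist p q := dist_nonneg
  have d1 := hf 0 ⟨le_rfl, hd⟩ s ⟨h0, h1⟩
  have d2 := hf s ⟨h0, h1⟩ _ ⟨hd, le_rfl⟩
  rw [e0, abs_of_nonpos (by linarith)] at d1
  rw [e1, abs_of_nonpos (by linarith)] at d2
  exact ⟨f s, by simp only [metricInterval, mem_ofPred_eq]; linarith, by linarith⟩

theorem ChainIn.of_metricInterval_subset (hX : IsGeodesicSpace X) {ρ : ℝ} (hρ : 0 < ρ)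
    {U : Set X} {p q : X} (hU : metricInterval p q ⊆ U) : ChainIn ρ U p q := by
  obtain ⟨I, hI, hc, hp, hq⟩ := hX.exists_isPathConnected p q
  exact (ChainIn.of_isPreconnected hρ hc.isConnected.isPreconnected hp hq).mono (hI.trans hU)

theorem ChainIn.of_joinedIn {ρ : ℝ} (hρ : 0 < ρ) {U : Set X} {p q : X} (h : JoinedIn U p q) :
    ChainIn ρ U p q := by
  obtain ⟨γ, hγ⟩ := h
  refine (ChainIn.of_isPreconnected hρ (isPreconnected_range γ.continuous) ⟨0, γ.source⟩
    ⟨1, γ.target⟩).mono ?_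
  rintro _ ⟨t, rfl⟩
  exact hγ t

/-- Each gap is filled by a geodesic shorter than `ρ`, whose points are within `ρ / 2` of one of its
ends. -/
theorem ChainIn.joinedIn (hX : IsGeodesicSpace X) {ρ : ℝ} (hρ : 0 < ρ) {U : Set X} {p q : X}
    (h : ChainIn ρ U p q) : JoinedIn {y | ∃ u ∈ U, dist y u ≤ ρ / 2} p q := by
  obtain ⟨hp, h⟩ := h
  have key : ∀ a b, a ∈ U → b ∈ U → dist a b < ρ →
      JoinedIn {y | ∃ u ∈ U, dist y u ≤ ρ / 2} a b := by
    intro a b ha hb hab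
    obtain ⟨I, hI, hc, hp, hq⟩ := hX.exists_isPathConnected a b
    refine (hc.joinedIn a hp b hq).mono fun y hy => ?_
    have := hI hy
    simp only [metricInterval, mem_ofPred_eq] at this
    rcases le_total (dist a y) (ρ / 2) with h | h
    · exact ⟨a, ha, by rwa [dist_comm]⟩
    · exact ⟨b, hb, by linarith⟩
  suffices q ∈ U ∧ JoinedIn {y | ∃ u ∈ U, dist y u ≤ ρ / 2} p q from this.2
  induction h with
  | refl => exact ⟨hp, key p p hp hp (by simpa)⟩
  | tail h₁ h₂ ih => exact ⟨h₂.1, ih.2.trans (key _ _ ih.1 h₂.1 h₂.2)⟩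

theorem exists_paths_of_chainIn (hX : IsGeodesicSpace X) {ρ d : ℝ} (hρ : 0 < ρ) {U V : Set X}
    {a₁ z₁ a₂ z₂ : X} (h₁ : ChainIn ρ U a₁ z₁) (h₂ : ChainIn ρ V a₂ z₂)
    (h : ∀ u ∈ U, ∀ v ∈ V, d + ρ ≤ dist u v) :
    ∃ (P₁ : Path a₁ z₁) (P₂ : Path a₂ z₂), d ≤ setDist (range P₁) (range P₂) := by
  obtain ⟨γ₁, hγ₁⟩ := h₁.joinedIn hX hρ
  obtain ⟨γ₂, hγ₂⟩ := h₂.joinedIn hX hρ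
  refine ⟨γ₁, γ₂, le_csInf ⟨_, mem_image2_of_mem (mem_range_self 0) (mem_range_self 0)⟩ ?_⟩
  rintro _ ⟨_, ⟨s, rfl⟩, _, ⟨t, rfl⟩, rfl⟩
  obtain ⟨u, hu, hu'⟩ := hγ₁ s
  obtain ⟨v, hv, hv'⟩ := hγ₂ t
  have := h u hu v hv
  have := dist_triangle4 u (γ₁ s) (γ₂ t) v
  rw [dist_comm] at hu'
  linarith

end Chains

/-! ### Connected metric graphs are geodesic spaces. -/

section Graphs

variable {X : Type*} [MetricSpace X]

/-- `p` and `q` are joined by a geodesic. -/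
def GeodesicJoined (p q : X) : Prop :=
  ∃ f : ℝ → X, f 0 = p ∧ f (dist p q) = q ∧
    ∀ s ∈ Icc 0 (dist p q), ∀ t ∈ Icc 0 (dist p q), dist (f s) (f t) = |s - t|

theorem GeodesicJoined.trans {p q w : X} (h₁ : GeodesicJoined p q) (h₂ : GeodesicJoined q w)
    (h : dist p w = dist p q + dist q w) : GeodesicJoined p w := by
  obtain ⟨f, f0, f1, hf⟩ := h₁
  obtain ⟨g, g0, g1, hg⟩ := h₂
  have n₁ : 0 ≤ dist p q := dist_nonneg
  have n₂ : 0 ≤ dist q w := dist_nonneg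
  -- Equality in the triangle inequality through `q` leaves no slack between points of the two
  -- halves.
  have mix : ∀ s ∈ Icc 0 (dist p q), ∀ t ∈ Icc (dist p q) (dist p w),
      dist (f s) (g (t - dist p q)) = t - s := by
    intro s hs t ht
    have ht' : t - dist p q ∈ Icc 0 (dist q w) := ⟨by linarith [ht.1], by linarith [ht.2]⟩
    have e1 := hf 0 ⟨le_rfl, n₁⟩ s hs
    have e2 := hf s hs _ ⟨n₁, le_rfl⟩
    have e3 := hg 0 ⟨le_rfl, n₂⟩ _ ht'
    have e4 := hg _ ht' _ ⟨n₂, le_rfl⟩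
    rw [f0, abs_of_nonpos (by linarith [hs.1])] at e1
    rw [f1, abs_of_nonpos (by linarith [hs.2])] at e2
    rw [g0, abs_of_nonpos (by linarith [ht'.1])] at e3
    rw [g1, abs_of_nonpos (by linarith [ht'.2])] at e4
    have := dist_triangle (f s) q (g (t - dist p q))
    have := dist_triangle4 p (f s) (g (t - dist p q)) w
    linarith
  refine ⟨fun s => if s ≤ dist p q then f s else g (s - dist p q), by simp [f0], ?_, ?_⟩
  · by_cases hw : dist p w ≤ dist p q
    · have : q = w := dist_eq_zero.1 (by linarith)
      simp only [← this]
      simpa using f1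
    · simp only [hw, if_false]
      rw [h, add_sub_cancel_left, g1]
  · intro s hs t ht
    by_cases h1 : s ≤ dist p q <;> by_cases h2 : t ≤ dist p q <;>
      simp only [h1, h2, if_true, if_false]
    · exact hf s ⟨hs.1, h1⟩ t ⟨ht.1, h2⟩
    · rw [mix s ⟨hs.1, h1⟩ t ⟨by linarith, ht.2⟩, abs_of_nonpos (by linarith)]
      ring
    · rw [dist_comm, mix t ⟨ht.1, h2⟩ s ⟨by linarith, hs.2⟩, abs_of_nonneg (by linarith)]
    · rw [hg _ ⟨by linarith, by linarith [hs.2]⟩ _ ⟨by linarith, by linarith [ht.2]⟩]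
      congr 1
      ring

theorem GeodesicJoined.refl (p : X) : GeodesicJoined p p :=
  ⟨fun _ => p, rfl, rfl, by
    simp only [dist_self, Icc_self, mem_singleton_iff]
    rintro s rfl t rfl
    simp⟩

theorem GeodesicJoined.of_isometry_Icc {f : ℝ → X} {a b : ℝ} (hab : a ≤ b)
    (hf : ∀ s ∈ Icc a b, ∀ t ∈ Icc a b, dist (f s) (f t) = |s - t|) :
    GeodesicJoined (f a) (f b) := by
  have hd : dist (f a) (f b) = b - a := by
    rw [hf a ⟨le_rfl, hab⟩ b ⟨hab, le_rfl⟩, abs_of_nonpos (by linarith)]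
    ring
  refine ⟨fun t => f (a + t), by simp, by simp [hd], ?_⟩
  rw [hd]
  intro s hs t ht
  rw [hf _ ⟨by linarith [hs.1], by linarith [hs.2]⟩ _ ⟨by linarith [ht.1], by linarith [ht.2]⟩]
  congr 1
  ring

theorem GeodesicJoined.symm {p q : X} (h : GeodesicJoined p q) : GeodesicJoined q p := by
  obtain ⟨f, f0, f1, hf⟩ := h
  refine ⟨fun t => f (dist p q - t), by simpa using f1, by simp [dist_comm q p, f0], ?_⟩
  rw [dist_comm q p]
  intro s hs t ht
  rw [hf _ ⟨by linarith [hs.2], by linarith [hs.1]⟩ _ ⟨by linarith [ht.2], by linarith [ht.1]⟩,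
    abs_sub_comm]
  congr 1
  ring

theorem IsStandardMetricGraph.isGeodesicSpace (hX : IsStandardMetricGraph X) :
    IsGeodesicSpace X := by
  obtain ⟨V, G, pt, hconn, hcov, hpt0, hswap, hVV, hsame, hdiff⟩ := hX
  have hpt1 : ∀ u v : V, G.Adj u v → pt u v 1 = v := fun u v h => by
    have := hswap u v h 1 (by simp)
    rw [← this, sub_self, hpt0 v u h.symm]
  have edge : ∀ u v : V, G.Adj u v → ∀ s ∈ Icc (0 : ℝ) 1, ∀ t ∈ Icc (0 : ℝ) 1,
      GeodesicJoined (pt u v s) (pt u v t) := by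
    have aux : ∀ u v : V, G.Adj u v → ∀ s ∈ Icc (0 : ℝ) 1, ∀ t ∈ Icc (0 : ℝ) 1, s ≤ t →
        GeodesicJoined (pt u v s) (pt u v t) := fun u v h s hs t ht hst =>
      .of_isometry_Icc hst fun a ha b hb =>
        hsame u v h a ⟨hs.1.trans ha.1, ha.2.trans ht.2⟩ b ⟨hs.1.trans hb.1, hb.2.trans ht.2⟩
    intro u v h s hs t ht
    rcases le_total s t with hst | hst
    · exact aux u v h s hs t ht hst
    · exact (aux u v h t ht s hs hst).symm
  have m0 : (0 : ℝ) ∈ Icc (0 : ℝ) 1 := by simp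
  have m1 : (1 : ℝ) ∈ Icc (0 : ℝ) 1 := by simp
  have toV : ∀ u v : V, G.Adj u v → ∀ s ∈ Icc (0 : ℝ) 1,
      (GeodesicJoined (pt u v s) (u : X) ∧ dist (pt u v s) (u : X) = s) ∧
      (GeodesicJoined (pt u v s) (v : X) ∧ dist (pt u v s) (v : X) = 1 - s) := by
    intro u v h s hs
    have e0 := edge u v h s hs 0 m0
    have e1 := edge u v h s hs 1 m1
    have d0 := hsame u v h s hs 0 m0
    have d1 := hsame u v h s hs 1 m1
    rw [hpt0 u v h] at e0 d0
    rw [hpt1 u v h] at e1 d1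
    rw [abs_of_nonneg (by linarith [hs.1])] at d0
    rw [abs_of_nonpos (by linarith [hs.2])] at d1
    exact ⟨⟨e0, by linarith⟩, e1, by linarith⟩
  -- The first edge of a shortest walk lowers the graph distance to the target by one, so
  -- concatenation stays geodesic.
  have vert : ∀ n : ℕ, ∀ u v : V, G.dist u v = n → GeodesicJoined (u : X) (v : X) := by
    intro n
    induction n with
    | zero =>
      intro u v h
      rw [hconn.dist_eq_zero_iff] at h
      rw [h]
      exact .refl _
    | succ n ih =>
      intro u v h
      obtain ⟨w, hw, hn⟩ : ∃ w, G.Adj u w ∧ G.dist w v = n := by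
        obtain ⟨p, hp⟩ := hconn.exists_walk_length_eq_dist u v
        cases p with
        | nil => simp at h
        | @cons _ w _ hadj p =>
          refine ⟨w, hadj, ?_⟩
          have h1 := SimpleGraph.dist_le p
          have h2 : G.dist u v ≤ G.dist u w + G.dist w v := hconn.dist_triangle
          have h3 := SimpleGraph.dist_eq_one_iff_adj.2 hadj
          rw [SimpleGraph.Walk.length_cons] at hp
          omega
      have d1 := (toV u w hw 0 m0).2
      rw [hpt0 u w hw] at d1
      refine d1.1.trans (ih w v hn) ?_
      rw [d1.2, hVV, hVV, h, hn]
      push_cast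
      ring
  have vert' : ∀ u v : V, GeodesicJoined (u : X) (v : X) := fun u v => vert _ u v rfl
  have EE : ∀ u v u' v' : V, G.Adj u v → G.Adj u' v' → ∀ s ∈ Icc (0 : ℝ) 1, ∀ t ∈ Icc (0 : ℝ) 1,
      GeodesicJoined (pt u v s) (pt u' v' t) := by
    intro u v u' v' h h' s hs t ht
    by_cases heq : s(u, v) = s(u', v')
    · rw [Sym2.eq_iff] at heq
      rcases heq with ⟨rfl, rfl⟩ | ⟨rfl, rfl⟩
      · exact edge u v h s hs t ht
      · rw [← hswap u v h s hs]
        exact edge v u h' _ ⟨by linarith [hs.2], by linarith [hs.1]⟩ t ht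
    · have hd := hdiff u v u' v' h h' heq s hs t ht
      have via : ∀ a b : V, GeodesicJoined (pt u v s) (a : X) →
          GeodesicJoined (pt u' v' t) (b : X) →
          dist (pt u v s) (pt u' v' t) =
            dist (pt u v s) (a : X) + G.dist a b + dist (pt u' v' t) (b : X) →
          GeodesicJoined (pt u v s) (pt u' v' t) := by
        intro a b ha hb hab
        rw [← hVV] at hab
        have t1 := dist_triangle (a : X) b (pt u' v' t)
        have t2 := dist_triangle (pt u v s) a (pt u' v' t)
        rw [dist_comm (pt u' v' t) (b : X)] at hab
        exact ha.trans ((vert' a b).trans hb.symm (by linarith)) (by linarith)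
      obtain ⟨⟨g1, d1⟩, g2, d2⟩ := toV u v h s hs
      obtain ⟨⟨g3, d3⟩, g4, d4⟩ := toV u' v' h' t ht
      rcases min_choice (min (s + G.dist u u' + t) (s + G.dist u v' + (1 - t)))
          (min ((1 - s) + G.dist v u' + t) ((1 - s) + G.dist v v' + (1 - t))) with e | e <;>
        rw [e] at hd
      · rcases min_choice (s + G.dist u u' + t) (s + G.dist u v' + (1 - t)) with e | e <;>
          rw [e] at hd
        · exact via u u' g1 g3 (by rw [hd, d1, d3])
        · exact via u v' g1 g4 (by rw [hd, d1, d4])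
      · rcases min_choice ((1 - s) + G.dist v u' + t) ((1 - s) + G.dist v v' + (1 - t)) with e | e
          <;> rw [e] at hd
        · exact via v u' g2 g3 (by rw [hd, d2, d3])
        · exact via v v' g2 g4 (by rw [hd, d2, d4])
  have VE : ∀ w u v : V, G.Adj u v → ∀ s ∈ Icc (0 : ℝ) 1,
      GeodesicJoined (w : X) (pt u v s) := by
    intro w u v h s hs
    -- Every vertex lies on an edge, since the graph is connected and has one; so `EE` applies.
    obtain ⟨w', hw'⟩ : ∃ w', G.Adj w w' := by
      by_cases hwu : w = u
      · exact ⟨v, hwu ▸ h⟩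
      · obtain ⟨p⟩ := hconn.preconnected w u
        cases p with
        | nil => exact absurd rfl hwu
        | cons hadj _ => exact ⟨_, hadj⟩
    rw [← hpt0 w w' hw']
    exact EE w w' u v hw' h 0 m0 s hs
  intro p q
  change GeodesicJoined p q
  rcases hcov p with hp | ⟨u, v, h, s, hs, rfl⟩ <;> rcases hcov q with hq | ⟨u', v', h', t, ht, rfl⟩
  · exact vert' ⟨p, hp⟩ ⟨q, hq⟩
  · exact VE ⟨p, hp⟩ u' v' h' t ht
  · exact (VE ⟨q, hq⟩ u v h s hs).symm
  · exact EE u v u' v' h h' s hs t ht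

end Graphs

/-! ### Greedy selection of overlapping sets on the line. -/

theorem exists_seq_of_backward {S : Type*} {n : ℕ} {good : ℕ → S → Prop} {rel : ℕ → S → S → Prop}
    {s₀ : S} (h₀ : good n s₀)
    (step : ∀ k < n, ∀ s', good (k + 1) s' → ∃ s, good k s ∧ rel k s s') :
    ∃ σ : ℕ → S, σ n = s₀ ∧ (∀ k ≤ n, good k (σ k)) ∧ ∀ k < n, rel k (σ k) (σ (k + 1)) := by
  induction n generalizing s₀ with
  | zero => exact ⟨fun _ => s₀, rfl, fun k hk => by simpa [Nat.le_zero.1 hk], by simp⟩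
  | succ n ih =>
    obtain ⟨s, hs, hr⟩ := step n n.lt_succ_self s₀ h₀
    obtain ⟨σ, hσ, hg, hrel⟩ := ih hs fun k hk => step k (hk.trans n.lt_succ_self)
    refine ⟨fun k => if k ≤ n then σ k else s₀, by simp, fun k hk => ?_, fun k hk => ?_⟩
    · rcases Nat.lt_or_eq_of_le hk with h | rfl
      · simpa [Nat.lt_succ_iff.1 h] using hg k (Nat.lt_succ_iff.1 h)
      · simpa using h₀
    · rcases Nat.lt_or_eq_of_le (Nat.lt_succ_iff.1 hk) with h | rfl
      · simpa [h.le, Nat.succ_le_of_lt h] using hrel k h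
      · simpa [hσ] using hr

/-- A family of sets of reals, one of which reaches far to the left and one far to the right, such
that every point of `[0, L]` is crossed by one of them with margin `W`, contains a chain of
overlapping sets in which sets at least three steps apart are separated by a gap. -/
theorem exists_overlapping_chain {ι : Type*} (T : ι → Set ℝ) {s f : ι} (hsf : s ≠ f)
    {L W θ g γ : ℝ} (hL : 0 ≤ L) (hg : 0 < g) (hθ : g < θ) (hγ : g ≤ γ) (hW : 2 * θ + γ ≤ 2 * W)
    (hT : ∀ i, i ≠ s → i ≠ f → T i ⊆ Icc 0 L)
    (hs : T s ⊆ insert (-W) (Icc 0 L)) (hs0 : -W ∈ T s)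
    (hf : T f ⊆ insert (L + W) (Icc 0 L)) (hf0 : L + W ∈ T f)
    (hcross : ∀ t ∈ Icc 0 L, ∃ i, ∃ u ∈ T i, ∃ v ∈ T i, u ≤ t - W ∧ t + W ≤ v) :
    ∃ (n : ℕ) (c : ℕ → ι) (a b : ℕ → ℝ), 0 < n ∧ c 0 = s ∧ c n = f ∧
      (∀ k, 0 < k → k ≤ n → c k ≠ s) ∧ (∀ k < n, c k ≠ f) ∧
      (∀ k ≤ n, a k ∈ T (c k) ∧ b k ∈ T (c k)) ∧
      (∀ k < n, a (k + 1) + g ≤ b k) ∧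
      (∀ k, 0 < k → k < n → a k + g ≤ a (k + 1)) ∧
      (∀ k, k + 1 < n → b k + g ≤ b (k + 1)) ∧
      ∀ k j, k + 3 ≤ j → j ≤ n → ∀ u ∈ T (c k), ∀ v ∈ T (c j), u + γ ≤ v := by
  have le_L : ∀ i, i ≠ f → ∀ u ∈ T i, u ≤ L := by
    intro i hi u hu
    by_cases h : i = s
    · subst h
      rcases hs hu with h | h
      · linarith
      · exact h.2
    · exact (hT i h hi hu).2
  have ge_W : ∀ i, ∀ u ∈ T i, -W ≤ u := by
    intro i u hu
    by_cases h : i = s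
    · subst h
      rcases hs hu with h | h
      · exact h.ge
      · linarith [h.1]
    · by_cases h' : i = f
      · subst h'
        rcases hf hu with h | h
        · linarith
        · linarith [h.1]
      · linarith [(hT i h h' hu).1]
  have eq_s : ∀ i, ∀ u ∈ T i, u < 0 → i = s := by
    intro i u hu hu0
    by_contra h
    by_cases h' : i = f
    · subst h'
      rcases hf hu with h | h
      · linarith
      · linarith [h.1]
    · linarith [(hT i h h' hu).1]
  -- `F t` is how far right the sets meeting `(-∞, t]` reach. The supremum is meaningful only under
  -- `nf t`, that is, before `T f` is among these sets.
  let F : ℝ → ℝ := fun t => sSup {b | ∃ i, ∃ a ∈ T i, a ≤ t ∧ b ∈ T i}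
  let nf : ℝ → Prop := fun t => -W ≤ t ∧ ∀ u ∈ T f, t < u
  have ne_f : ∀ t, nf t → ∀ i, ∀ a ∈ T i, a ≤ t → i ≠ f := by
    rintro t ht i a ha hat rfl
    linarith [ht.2 a ha]
  have bdd : ∀ t, nf t → BddAbove {b | ∃ i, ∃ a ∈ T i, a ≤ t ∧ b ∈ T i} := by
    rintro t ht
    refine ⟨L, ?_⟩
    rintro b ⟨i, a, ha, hat, hb⟩
    exact le_L i (ne_f t ht i a ha hat) b hb
  have nemp : ∀ t, nf t → {b | ∃ i, ∃ a ∈ T i, a ≤ t ∧ b ∈ T i}.Nonempty :=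
    fun t ht => ⟨-W, s, -W, hs0, ht.1, hs0⟩
  have F1 : ∀ t, nf t → ∀ i, ∀ a ∈ T i, a ≤ t → ∀ b ∈ T i, b ≤ F t :=
    fun t ht i a ha hat b hb => le_csSup (bdd t ht) ⟨i, a, ha, hat, hb⟩
  have F2 : ∀ t, nf t → F t ≤ L := by
    intro t ht
    refine csSup_le (nemp t ht) ?_
    rintro b ⟨i, a, ha, hat, hb⟩
    exact le_L i (ne_f t ht i a ha hat) b hb
  have F4 : ∀ t, nf t → ∀ x < F t, ∃ i, ∃ a ∈ T i, a ≤ t ∧ ∃ b ∈ T i, x < b := by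
    intro t ht x hx
    obtain ⟨b, ⟨i, a, ha, hat, hb⟩, hxb⟩ := exists_lt_of_lt_csSup (nemp t ht) hx
    exact ⟨i, a, ha, hat, b, hb, hxb⟩
  have nfL : ∀ t, nf t → t < L - W := by
    intro t ht
    obtain ⟨i, u, hu, v, hv, h1, h2⟩ := hcross L ⟨hL, le_rfl⟩
    have : i = f := by
      by_contra hi
      linarith [le_L i hi v hv]
    subst this
    linarith [ht.2 u hu]
  have F3 : ∀ t, nf t → t + 2 * W ≤ F t := by
    intro t ht
    obtain ⟨i, u, hu, v, hv, h1, h2⟩ := hcross (t + W) ⟨by linarith [ht.1], by linarith [nfL t ht]⟩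
    linarith [F1 t ht i u hu (by linarith) v hv]
  -- Retreating by `θ > g` lets a set that almost attains the supremum overlap its successor by `g`.
  let τ : ℕ → ℝ := fun k => Nat.rec (-W) (fun _ t => F t - θ) k
  have τ0 : τ 0 = -W := rfl
  have τs : ∀ k, τ (k + 1) = F (τ k) - θ := fun k => rfl
  have hex : ∃ n, ¬ nf (τ n) := by
    by_contra! h
    have hge : ∀ k : ℕ, -W + k * (2 * W - θ) ≤ τ k := by
      intro k
      induction k with
      | zero => simp [τ0]
      | succ k ih =>
        rw [τs]
        push_cast
        linarith [F3 _ (h k)]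
    obtain ⟨k, hk⟩ := exists_nat_gt (L / (2 * W - θ))
    rw [div_lt_iff₀ (by linarith)] at hk
    linarith [hge k, nfL _ (h k)]
  let _ : DecidablePred fun n => ¬ nf (τ n) := Classical.decPred _
  obtain ⟨n, hn, hmin⟩ : ∃ n, ¬ nf (τ n) ∧ ∀ k < n, nf (τ k) :=
    ⟨Nat.find hex, Nat.find_spec hex, fun k hk => not_not.1 (Nat.find_min hex hk)⟩
  have nf0 : nf (τ 0) := by
    refine ⟨le_rfl, fun u hu => ?_⟩
    rw [τ0]
    rcases hf hu with h | h
    · linarith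
    · linarith [h.1]
  have hn0 : 0 < n := Nat.pos_of_ne_zero (by rintro rfl; exact hn nf0)
  have τge : ∀ k, k < n → W - θ ≤ τ (k + 1) := fun k hk => by
    rw [τs]
    linarith [F3 _ (hmin k hk), (hmin k hk).1]
  obtain ⟨af, haf, haf'⟩ : ∃ u ∈ T f, u ≤ τ n := by
    by_contra! h
    refine hn ⟨?_, h⟩
    obtain ⟨k, rfl⟩ := Nat.exists_eq_succ_of_ne_zero hn0.ne'
    linarith [τge k k.lt_succ_self]
  -- The sets are chosen backwards from `f`. Reaching beyond `F (τ j)` forces a set to lie entirely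
  -- to the right of `τ j`, which yields `lower`.
  obtain ⟨σ, hσn, hgood, hrel⟩ := exists_seq_of_backward (n := n) (S := ι × ℝ × ℝ)
    (good := fun k p => p.2.1 ∈ T p.1 ∧ p.2.2 ∈ T p.1 ∧ p.2.1 ≤ τ k ∧
      ∀ j, k = j + 1 → F (τ j) + g ≤ p.2.2)
    (rel := fun k p q => q.2.1 + g ≤ p.2.2 ∧ (0 < k → p.2.1 + g ≤ q.2.1))
    (s₀ := (f, af, L + W)) ⟨haf, hf0, haf', fun j hj => by
      linarith [F2 _ (hmin j (by omega))]⟩ (by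
    rintro k hk ⟨i', a', b'⟩ ⟨ha', hb', hle, hF⟩
    dsimp only at ha' hb' hle hF ⊢
    have hnf := hmin k hk
    have hF3 := F3 _ hnf
    rw [τs] at hle
    -- A set almost attaining `F (τ k)` has left foot at most `τ k`. If that may be too close to
    -- `a'`, a set crossing `τ k + W - g` is used instead: its left foot is at most `τ k - g`.
    by_cases hcase : 0 < k → τ k + g ≤ a'
    · obtain ⟨i, a, ha, hak, b, hb, hlt⟩ := F4 _ hnf (F (τ k) - (θ - g)) (by linarith)
      refine ⟨(i, a, b), ⟨ha, hb, hak, ?_⟩, by dsimp only; linarith,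
        fun h => by dsimp only; linarith [hcase h]⟩
      rintro j rfl
      rw [τs] at hF3
      dsimp only
      rw [τs] at hlt
      linarith
    · push Not at hcase
      obtain ⟨hk0, hcase⟩ := hcase
      obtain ⟨j, rfl⟩ := Nat.exists_eq_succ_of_ne_zero hk0.ne'
      have hτ := τge j (by omega)
      obtain ⟨i, u, hu, v, hv, h1, h2⟩ := hcross (τ (j + 1) + W - g)
        ⟨by linarith, by linarith [nfL _ hnf]⟩
      have ha'τ : τ (j + 1) < a' := by
        by_contra! h
        linarith [F1 _ hnf i' a' ha' h b' hb', hF _ rfl]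
      refine ⟨(i, u, v), ⟨hu, hv, ?_, ?_⟩, ?_, fun _ => ?_⟩
      · dsimp only [Nat.succ_eq_add_one]; linarith
      · rintro j' hj'
        obtain rfl : j = j' := by simpa using hj'
        have := τs j
        dsimp only
        linarith
      · dsimp only; linarith
      · dsimp only; linarith)
  have upper : ∀ k < n, ∀ u ∈ T (σ k).1, u ≤ F (τ k) := fun k hk u hu =>
    F1 _ (hmin k hk) _ _ (hgood k hk.le).1 (hgood k hk.le).2.2.1 u hu
  have lower : ∀ k < n, ∀ u ∈ T (σ (k + 1)).1, τ k < u := by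
    intro k hk u hu
    by_contra! h
    have := F1 _ (hmin k hk) _ u hu h _ (hgood (k + 1) hk).2.1
    linarith [(hgood (k + 1) hk).2.2.2 k rfl]
  refine ⟨n, fun k => (σ k).1, fun k => (σ k).2.1, fun k => (σ k).2.2, hn0, ?_,
    by simp [hσn], ?_, ?_,
    fun k hk => ⟨(hgood k hk).1, (hgood k hk).2.1⟩, fun k hk => (hrel k hk).1,
    fun k hk0 hk => (hrel k hk).2 hk0, ?_, ?_⟩
  · have := (hgood 0 hn0.le).2.2.1
    rw [τ0] at this
    exact eq_s _ _ (hgood 0 hn0.le).1 (by linarith)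
  · intro k hk0 hk h
    obtain ⟨j, rfl⟩ := Nat.exists_eq_succ_of_ne_zero hk0.ne'
    have := lower j (by omega) (-W) (by dsimp only [Nat.succ_eq_add_one] at h; rw [h]; exact hs0)
    linarith [(hmin j (by omega)).1]
  · intro k hk h
    have := upper k hk (L + W) (by dsimp only at h; rw [h]; exact hf0)
    linarith [F2 _ (hmin k hk)]
  · intro k hk
    have h1 := upper k (by omega) _ (hgood k (by omega)).2.1
    have h2 := (hgood (k + 1) hk.le).2.2.2 k rfl
    dsimp only
    linarith
  -- Here `u ≤ τ (k + 1) + θ`, while `v` exceeds `τ (j - 1) ≥ τ (k + 2) ≥ τ (k + 1) + 2 * W - θ`;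
  -- `hW` bounds the difference.
  · intro k j hkj hjn u hu v hv
    obtain ⟨j, rfl⟩ := Nat.exists_eq_add_of_le' (show 1 ≤ j by omega)
    have h1 := upper k (by omega) u hu
    have h2 := lower j (by omega) v hv
    have mono : ∀ i, k + 2 + i ≤ j → τ (k + 2) ≤ τ (k + 2 + i) := by
      intro i
      induction i with
      | zero => intro _; exact le_rfl
      | succ i ih =>
        intro h
        have := F3 _ (hmin (k + 2 + i) (by omega))
        have := ih (by omega)
        rw [← add_assoc, τs]
        linarith
    have h3 := mono (j - (k + 2)) (by omega)
    rw [show k + 2 + (j - (k + 2)) = j by omega] at h3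
    have h4 := F3 _ (hmin (k + 1) (by omega))
    have h5 := τs (k + 1)
    have h6 := τs k
    linarith

/-! ### Two paths leapfrogging along a chain of bridges. -/

section BridgeChains

variable {X : Type*} [MetricSpace X]

/-- The points at distance at least `d` from the curve `P` on `[0, L]`. -/
def Far (P : ℝ → X) (L d : ℝ) : Set X := {y | ∀ t ∈ Icc 0 L, d ≤ dist y (P t)}

theorem Far.anti {P : ℝ → X} {L d d' : ℝ} (h : d ≤ d') : Far P L d' ⊆ Far P L d :=
  fun _ hy t ht => h.trans (hy t ht)

theorem dist_le_of_mem_metricInterval_left {p q y : X} (h : y ∈ metricInterval p q) :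
    dist p y ≤ dist p q := by
  have : dist p y + dist y q = dist p q := h
  linarith [dist_nonneg (x := y) (y := q)]

theorem dist_le_of_mem_metricInterval_right {p q y : X} (h : y ∈ metricInterval p q) :
    dist y q ≤ dist p q := by
  have : dist p y + dist y q = dist p q := h
  linarith [dist_nonneg (x := p) (y := y)]

/-- A chain of bridges over the geodesic `P` on `[0, L]`, leading from `A` to `Z`. Consecutive
bridges are either `close`, and then joined by a short jump from `p j` to `q j`, or well separated,
and then they overlap in the sense that the left foot `α (j + 1)` of the next bridge precedes the
right foot `β j` of the previous one. -/
structure BridgeChain (ρ : ℝ) (P : ℝ → X) (L : ℝ) (A Z : Set X) where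
  N : ℕ
  /-- the part of the bridge that is far away from `P` -/
  core : ℕ → Set X
  /-- the points by whose distances closeness of bridges is measured -/
  att : ℕ → Set X
  /-- the points of the bridge that may be used for jumps and feet -/
  hub : ℕ → Set X
  close : ℕ → Prop
  α : ℕ → ℝ
  β : ℕ → ℝ
  p : ℕ → X
  q : ℕ → X
  la : ℕ → X
  lb : ℕ → X
  N_pos : 0 < N
  rho_pos : 0 < ρ
  L_nonneg : 0 ≤ L
  isom : ∀ s ∈ Icc 0 L, ∀ t ∈ Icc 0 L, dist (P s) (P t) = |s - t|
  core_subset : ∀ j ≤ N, core j ⊆ att j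
  core_far : ∀ j ≤ N, core j ⊆ Far P L (150 * ρ)
  not_close_last : ¬ close N
  α_last : α (N + 1) = L
  α_mem : ∀ j, 0 < j → j ≤ N + 1 → α j ∈ Icc 0 L
  β_mem : ∀ j < N, β j ∈ Icc 0 L
  -- Two legs of length `150 * ρ` whose feet are `310 * ρ` apart stay more than `9 * ρ` apart.
  α_add : ∀ i j, 0 < i → i < j → j ≤ N + 1 → α i + 310 * ρ ≤ α j
  β_add : ∀ i j, i < j → j < N → β i + 310 * ρ ≤ β j
  α_add_le_β : ∀ j < N, ¬ close j → α (j + 1) + 310 * ρ ≤ β j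
  β_add_le_α : ∀ i j, i + 3 ≤ j → j ≤ N + 1 → β i + 310 * ρ ≤ α j
  p_mem : ∀ j < N, close j → p j ∈ att j ∧ p j ∈ hub j
  q_mem : ∀ j < N, close j → q j ∈ att (j + 1) ∧ q j ∈ hub (j + 1)
  jump_lt : ∀ j < N, close j → dist (p j) (q j) < 60 * ρ
  jump_far : ∀ j < N, close j →
    metricInterval (p j) (q j) ⊆ Far P L (150 * ρ - dist (p j) (q j))
  lb_mem : ∀ j < N, ¬ close j → lb j ∈ hub j
  lb_dist : ∀ j < N, ¬ close j → dist (lb j) (P (β j)) ≤ 150 * ρ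
  lb_att : ∀ j < N, ¬ close j → lb j ∈ att j ∨ dist (lb j) (P (β j)) < 80 * ρ
  la_mem : ∀ j < N, ¬ close j → la (j + 1) ∈ hub (j + 1)
  la_dist : ∀ j < N, ¬ close j → dist (la (j + 1)) (P (α (j + 1))) ≤ 150 * ρ
  la_att : ∀ j < N, ¬ close j → la (j + 1) ∈ att (j + 1) ∨
    dist (la (j + 1)) (P (α (j + 1))) < 80 * ρ
  sep₁ : ∀ j < N, ¬ close j → ∀ c ∈ att j, ∀ c' ∈ att (j + 1), 20 * ρ ≤ dist c c'
  sep₂ : ∀ j, j + 2 ≤ N → ∀ c ∈ att j, ∀ c' ∈ att (j + 2), 60 * ρ ≤ dist c c' ∧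
    (close j → 2 * dist (p j) (q j) + 18 * ρ ≤ dist c c') ∧
    (close (j + 1) → 2 * dist (p (j + 1)) (q (j + 1)) + 18 * ρ ≤ dist c c')
  sep₃ : ∀ i j, i + 3 ≤ j → j ≤ N → ∀ c ∈ att i, ∀ c' ∈ att j, 140 * ρ ≤ dist c c'
  conn_first : ∀ c ∈ hub 0, ∃ a ∈ A, ChainIn ρ (core 0 ∪ {c}) a c
  conn_mid : ∀ j, 0 < j → j < N → ∀ c ∈ hub j, ∀ c' ∈ hub j, ChainIn ρ (core j) c c'
  conn_last : ∀ c ∈ hub N, ∃ z ∈ Z, ChainIn ρ (core N ∪ {c}) c z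

namespace BridgeChain

variable {ρ : ℝ} {P : ℝ → X} {L : ℝ} {A Z : Set X} (B : BridgeChain ρ P L A Z)

open Classical in
/-- The colour of the path that uses the `j`-th bridge. -/
noncomputable def color (j : ℕ) : Bool :=
  Nat.rec false (fun j c => if B.close j then c else !c) j

open Classical in
/-- The parameter at which the other path waits while the `j`-th bridge is traversed. -/
noncomputable def wait (j : ℕ) : ℝ :=
  Nat.rec 0 (fun j w => if B.close j then w else B.β j) j

theorem color_succ_of_close {j : ℕ} (h : B.close j) : B.color (j + 1) = B.color j := by
  simp [color, h]

theorem color_succ_of_not_close {j : ℕ} (h : ¬ B.close j) : B.color (j + 1) = !B.color j := by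
  simp [color, h]

theorem wait_succ_of_close {j : ℕ} (h : B.close j) : B.wait (j + 1) = B.wait j := by
  simp [wait, h]

theorem wait_succ_of_not_close {j : ℕ} (h : ¬ B.close j) : B.wait (j + 1) = B.β j := by
  simp [wait, h]

theorem exists_not_close {i j : ℕ} (hij : i ≤ j) (h : B.color i ≠ B.color j) :
    ∃ k, i ≤ k ∧ k < j ∧ ¬ B.close k := by
  by_contra! hc
  apply h
  induction j, hij using Nat.le_induction with
  | base => rfl
  | succ j hij ih =>
    by_cases hj : B.color i = B.color j
    · rw [hj, B.color_succ_of_close (hc j hij j.lt_succ_self)]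
    · exact absurd (ih hj fun k hk hk' => hc k hk (hk'.trans j.lt_succ_self)) hj

theorem wait_eq (j : ℕ) : B.wait j = 0 ∨ ∃ h < j, ¬ B.close h ∧ B.wait j = B.β h := by
  induction j with
  | zero => exact .inl rfl
  | succ j ih =>
    by_cases hj : B.close j
    · rw [B.wait_succ_of_close hj]
      rcases ih with h | ⟨h, hh, h'⟩
      · exact .inl h
      · exact .inr ⟨h, hh.trans j.lt_succ_self, h'⟩
    · exact .inr ⟨j, j.lt_succ_self, hj, B.wait_succ_of_not_close hj⟩

theorem wait_mem {j : ℕ} (hj : j ≤ B.N) : B.wait j ∈ Icc 0 L := by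
  rcases B.wait_eq j with h | ⟨h, hh, -, h'⟩
  · rw [h]
    exact ⟨le_rfl, B.L_nonneg⟩
  · rw [h']
    exact B.β_mem h (by omega)

theorem β_mono {i j : ℕ} (hij : i ≤ j) (hj : j < B.N) : B.β i ≤ B.β j := by
  rcases hij.eq_or_lt with rfl | h
  · exact le_rfl
  · linarith [B.β_add i j h hj, B.rho_pos]

theorem β_le_wait {i j : ℕ} (hij : i < j) (hj : j ≤ B.N) (hi : ¬ B.close i) :
    B.β i ≤ B.wait j := by
  induction j, hij using Nat.le_induction with
  | base => rw [B.wait_succ_of_not_close hi]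
  | succ j hij ih =>
    by_cases h : B.close j
    · rw [B.wait_succ_of_close h]
      exact ih (by omega)
    · rw [B.wait_succ_of_not_close h]
      exact B.β_mono (by omega) (by omega)

/-- The parameters used, in stage `j`, by the path that does not use the `j`-th bridge. -/
def stage (j : ℕ) : Set ℝ :=
  {t | t = B.wait j ∨ (¬ B.close j ∧ t ∈ uIcc (B.wait j) (B.α (j + 1)))}

theorem stage_subset {j : ℕ} (hj : j ≤ B.N) : B.stage j ⊆ Icc 0 L := by
  rintro t (rfl | ⟨-, ht⟩)
  · exact B.wait_mem hj
  · exact uIcc_subset_Icc (B.wait_mem hj) (B.α_mem _ j.succ_pos (by omega)) ht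

/-- Different colours force a non-close pair `i, i + 1` between the stages, so in stage `j'` the
waiting point is at or beyond `β i`. Everything in stage `j` precedes both `β i` and `α (j' + 1)`.
-/
theorem stage_add_le {j j' : ℕ} (hjj' : j < j') (hj' : j' ≤ B.N) (hc : B.color j ≠ B.color j')
    {t t' : ℝ} (ht : t ∈ B.stage j) (ht' : t' ∈ B.stage j') : t + 310 * ρ ≤ t' := by
  obtain ⟨i, hji, hij', hi⟩ := B.exists_not_close hjj'.le hc
  have w₁ : B.wait j + 310 * ρ ≤ B.β i := by
    rcases B.wait_eq j with h | ⟨h, hh, -, h'⟩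
    · rw [h]
      linarith [B.α_add_le_β i (by omega) hi, (B.α_mem (i + 1) i.succ_pos (by omega)).1]
    · rw [h']
      exact B.β_add h i (by omega) (by omega)
  have w₂ : B.wait j + 310 * ρ ≤ B.α (j' + 1) := by
    rcases B.wait_eq j with h | ⟨h, hh, -, h'⟩
    · rw [h]
      linarith [B.α_add 1 (j' + 1) one_pos (by omega) (by omega),
        (B.α_mem 1 one_pos (by omega)).1]
    · rw [h']
      exact B.β_add_le_α h _ (by omega) (by omega)
  have key : t + 310 * ρ ≤ B.β i ∧ t + 310 * ρ ≤ B.α (j' + 1) := by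
    rcases ht with rfl | ⟨hj, ht⟩
    · exact ⟨w₁, w₂⟩
    · have a₁ : B.α (j + 1) + 310 * ρ ≤ B.β i :=
        (B.α_add_le_β j (by omega) hj).trans (B.β_mono hji (by omega))
      have a₂ := B.α_add (j + 1) (j' + 1) (by omega) (by omega) (by omega)
      rcases le_max_iff.1 ht.2 with h | h <;> exact ⟨by linarith, by linarith⟩
  have hβ := B.β_le_wait hij' hj' hi
  rcases ht' with rfl | ⟨-, ht'⟩
  · linarith [key.1]
  · rcases min_le_iff.1 ht'.1 with h | h
    · linarith [key.1]
    · linarith [key.2]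

/-- The parameters used by the path of colour `κ`. -/
def locus (κ : Bool) : Set ℝ := {t | ∃ j ≤ B.N, B.color j ≠ κ ∧ t ∈ B.stage j}

theorem locus_subset (κ : Bool) : B.locus κ ⊆ Icc 0 L := by
  rintro t ⟨j, hj, -, ht⟩
  exact B.stage_subset hj ht

theorem locus_sep {κ : Bool} {t t' : ℝ} (ht : t ∈ B.locus κ) (ht' : t' ∈ B.locus (!κ)) :
    310 * ρ ≤ |t - t'| := by
  obtain ⟨j, hj, hκ, ht⟩ := ht
  obtain ⟨j', hj', hκ', ht'⟩ := ht'
  have hne : B.color j ≠ B.color j' := by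
    rintro h
    rw [h] at hκ
    cases κ <;> simp_all
  rcases lt_trichotomy j j' with h | rfl | h
  · rw [abs_sub_comm]
    exact le_trans (by linarith [B.stage_add_le h hj' hne ht ht']) (le_abs_self _)
  · exact absurd rfl hne
  · exact le_trans (by linarith [B.stage_add_le h hj hne.symm ht' ht]) (le_abs_self _)

/-- The bridges and jumps used by the path of colour `κ`. -/
def away (κ : Bool) : Set X :=
  {y | (∃ j ≤ B.N, B.color j = κ ∧ y ∈ B.core j) ∨
    ∃ j < B.N, B.close j ∧ B.color j = κ ∧ y ∈ metricInterval (B.p j) (B.q j)}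

theorem att_sep {i j : ℕ} (hi : i ≤ B.N) (hj : j ≤ B.N) (hc : B.color i ≠ B.color j) {c c' : X}
    (h : c ∈ B.att i) (h' : c' ∈ B.att j) : 20 * ρ ≤ dist c c' := by
  wlog hij : i < j generalizing i j c c'
  · have hji : j < i := lt_of_le_of_ne (not_lt.1 hij) (by rintro rfl; exact hc rfl)
    rw [dist_comm]
    exact this hj hi hc.symm h' h hji
  have hρ := B.rho_pos
  obtain h1 | rfl | h1 : j = i + 1 ∨ j = i + 2 ∨ i + 3 ≤ j := by omega
  · subst h1
    refine B.sep₁ i hj (fun hcl => hc (B.color_succ_of_close hcl).symm) c h c' h'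
  · linarith [(B.sep₂ i hj c h c' h').1]
  · linarith [B.sep₃ i j h1 hj c h c' h']

/-- Bridges `j` and `j + 1` have the same colour, so `i` is neither. The end of the jump further
from bridge `i` along the chain is then at least two steps away, and `e` is within the jump length
of it. -/
theorem att_jump_sep {i j : ℕ} (hi : i ≤ B.N) (hj : j < B.N) (hcl : B.close j)
    (hc : B.color i ≠ B.color j) {c e : X} (h : c ∈ B.att i)
    (he : e ∈ metricInterval (B.p j) (B.q j)) :
    dist (B.p j) (B.q j) + 18 * ρ ≤ dist c e := by
  have hρ := B.rho_pos
  have hc' : B.color i ≠ B.color (j + 1) := by rwa [B.color_succ_of_close hcl]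
  have hlt := B.jump_lt j hj hcl
  have hp := (B.p_mem j hj hcl).1
  have hq := (B.q_mem j hj hcl).1
  have hl := dist_le_of_mem_metricInterval_left he
  have hr := dist_le_of_mem_metricInterval_right he
  have t₁ := dist_triangle c e (B.q j)
  have t₂ := dist_triangle c e (B.p j)
  rw [dist_comm e (B.p j)] at t₂
  obtain rfl | h1 | rfl | h1 : i + 1 = j ∨ i + 1 < j ∨ i = j + 2 ∨ j + 2 < i := by
    have : i ≠ j := by rintro rfl; exact hc rfl
    have : i ≠ j + 1 := by rintro rfl; exact hc' rfl
    omega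
  · linarith [(B.sep₂ i hj c h _ hq).2.2 hcl]
  · linarith [B.sep₃ i (j + 1) (by omega) hj c h _ hq]
  · have := (B.sep₂ j hi _ hp c h).2.1 hcl
    rw [dist_comm _ c] at this
    linarith
  · have := B.sep₃ j i (by omega) hi _ hp c h
    rw [dist_comm _ c] at this
    linarith

theorem jump_jump_sep {i j : ℕ} (hi : i < B.N) (hj : j < B.N) (hi' : B.close i) (hj' : B.close j)
    (hc : B.color i ≠ B.color j) {e e' : X} (he : e ∈ metricInterval (B.p i) (B.q i))
    (he' : e' ∈ metricInterval (B.p j) (B.q j)) : 20 * ρ ≤ dist e e' := by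
  wlog hij : i < j generalizing i j e e'
  · have hji : j < i := lt_of_le_of_ne (not_lt.1 hij) (by rintro rfl; exact hc rfl)
    rw [dist_comm]
    exact this hj hi hj' hi' hc.symm he' he hji
  have : i + 1 ≠ j := by
    rintro rfl
    exact hc (B.color_succ_of_close hi').symm
  have h₁ := B.sep₃ i (j + 1) (by omega) hj _ (B.p_mem i hi hi').1 _ (B.q_mem j hj hj').1
  have h₂ := dist_triangle4 (B.p i) e e' (B.q j)
  linarith [B.jump_lt i hi hi', B.jump_lt j hj hj', dist_le_of_mem_metricInterval_left he,
    dist_le_of_mem_metricInterval_right he']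

theorem away_sep {κ : Bool} {e e' : X} (he : e ∈ B.away κ) (he' : e' ∈ B.away (!κ)) :
    9 * ρ ≤ dist e e' := by
  have hρ := B.rho_pos
  have ne : ∀ {i j}, B.color i = κ → B.color j = !κ → B.color i ≠ B.color j := by
    intro i j h h'
    rw [h, h']
    simp
  rcases he with ⟨i, hi, hci, he⟩ | ⟨i, hi, hcl, hci, he⟩ <;>
    rcases he' with ⟨j, hj, hcj, he'⟩ | ⟨j, hj, hcl', hcj, he'⟩
  · linarith [B.att_sep hi hj (ne hci hcj) (B.core_subset i hi he) (B.core_subset j hj he')]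
  · linarith [B.att_jump_sep hi hj hcl' (ne hci hcj) (B.core_subset i hi he) he',
      dist_nonneg (x := B.p j) (y := B.q j)]
  · rw [dist_comm]
    linarith [B.att_jump_sep hj hi hcl (ne hci hcj).symm (B.core_subset j hj he') he,
      dist_nonneg (x := B.p i) (y := B.q i)]
  · linarith [B.jump_jump_sep hi hj hcl hcl' (ne hci hcj) he he']

theorem away_far (κ : Bool) : B.away κ ⊆ Far P L (90 * ρ) := by
  have hρ := B.rho_pos
  rintro y (⟨j, hj, -, hy⟩ | ⟨j, hj, hcl, -, hy⟩)
  · exact Far.anti (by linarith) (B.core_far j hj hy)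
  · exact Far.anti (by linarith [B.jump_lt j hj hcl]) (B.jump_far j hj hcl hy)

/-- Let `d` be the length of the jump containing `e`, or `0` if `e` is in a core. Were `e` within `9
* ρ` of `y`, its distance `150 * ρ - d` from `P` would put `y` within `9 * ρ + d` of `c`, hence `e`
within `18 * ρ + d` of `c`. Legs shorter than `80 * ρ` are safe because `away` keeps `90 * ρ` from
`P`. -/
theorem leg_sep {j : ℕ} (hj : j ≤ B.N) {c y e : X} {t : ℝ} (ht : t ∈ Icc 0 L)
    (hd : dist c (P t) ≤ 150 * ρ) (hc : c ∈ B.att j ∨ dist c (P t) < 80 * ρ)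
    (hy : y ∈ metricInterval c (P t)) (he : e ∈ B.away (!B.color j)) : 9 * ρ ≤ dist y e := by
  have hρ := B.rho_pos
  have hy' : dist c y + dist y (P t) = dist c (P t) := hy
  have h₁ := dist_triangle_left e (P t) y
  have h₂ := dist_triangle c y e
  have h₃ := dist_nonneg (x := c) (y := y)
  rcases hc with hc | hc
  · by_contra! hlt
    rcases he with ⟨i, hi, hci, he⟩ | ⟨i, hi, hcl, hci, he⟩
    · have := B.core_far i hi he t ht
      have := B.att_sep hj hi (by rw [hci]; simp) hc (B.core_subset i hi he)
      linarith
    · have := B.jump_far i hi hcl he t ht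
      have := B.att_jump_sep hj hi hcl (by rw [hci]; simp) hc he
      linarith
  · have := B.away_far _ he t ht
    linarith

/-- The part of the path of colour `κ` that runs close to `P`. -/
def along (κ : Bool) : Set X :=
  {y | (∃ t ∈ B.locus κ, dist y (P t) ≤ 150 * ρ) ∧ ∀ e ∈ B.away (!κ), 9 * ρ ≤ dist y e}

/-- The region of the path of colour `κ`. -/
def region (κ : Bool) : Set X := B.away κ ∪ B.along κ

theorem region_sep {κ : Bool} {y y' : X} (hy : y ∈ B.region κ) (hy' : y' ∈ B.region (!κ)) :
    9 * ρ ≤ dist y y' := by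
  have hρ := B.rho_pos
  rcases hy with hy | hy <;> rcases hy' with hy' | hy'
  · exact B.away_sep hy hy'
  · rw [dist_comm]
    exact hy'.2 y (by rwa [Bool.not_not])
  · exact hy.2 y' hy'
  · obtain ⟨⟨t, ht, h⟩, -⟩ := hy
    obtain ⟨⟨t', ht', h'⟩, -⟩ := hy'
    have h₁ := B.locus_sep ht ht'
    rw [← B.isom t (B.locus_subset _ ht) t' (B.locus_subset _ ht')] at h₁
    have := dist_triangle4_right (P t) (P t') y y'
    have := dist_triangle4 (P t) y y' (P t')
    rw [dist_comm (P t) y] at this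
    linarith

theorem core_subset_region {j : ℕ} (hj : j ≤ B.N) : B.core j ⊆ B.region (B.color j) :=
  fun _ hy => .inl (.inl ⟨j, hj, rfl, hy⟩)

theorem jump_subset_region {j : ℕ} (hj : j < B.N) (hcl : B.close j) :
    metricInterval (B.p j) (B.q j) ⊆ B.region (B.color j) :=
  fun _ hy => .inl (.inr ⟨j, hj, hcl, rfl, hy⟩)

theorem leg_subset_region {j : ℕ} (hj : j ≤ B.N) {c : X} {t : ℝ}
    (hd : dist c (P t) ≤ 150 * ρ) (hc : c ∈ B.att j ∨ dist c (P t) < 80 * ρ)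
    (hκ : t ∈ B.locus (B.color j)) : metricInterval c (P t) ⊆ B.region (B.color j) :=
  fun _ hy => .inr ⟨⟨t, hκ, (dist_le_of_mem_metricInterval_right hy).trans hd⟩,
    fun _ he => B.leg_sep hj (B.locus_subset _ hκ) hd hc hy he⟩

theorem curve_mem_region {κ : Bool} {t : ℝ} (ht : t ∈ B.locus κ) : P t ∈ B.region κ := by
  have hρ := B.rho_pos
  refine .inr ⟨⟨t, ht, by simp [hρ.le]⟩, fun e he => ?_⟩
  rw [dist_comm]
  linarith [B.away_far _ he t (B.locus_subset _ ht)]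

theorem chainIn_curve {κ : Bool} {s t : ℝ} (h : uIcc s t ⊆ B.locus κ) :
    ChainIn ρ (B.region κ) (P s) (P t) := by
  have hc : ContinuousOn P (uIcc s t) := continuousOn_of_dist_eq_abs_sub fun a ha b hb =>
    B.isom a (B.locus_subset _ (h ha)) b (B.locus_subset _ (h hb))
  refine (ChainIn.of_isPreconnected B.rho_pos (isPreconnected_uIcc.image P hc)
    (mem_image_of_mem P left_mem_uIcc) (mem_image_of_mem P right_mem_uIcc)).mono ?_
  rintro _ ⟨a, ha, rfl⟩
  exact B.curve_mem_region (h ha)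

/-- The set in which the path of colour `κ` starts. -/
def source (_B : BridgeChain ρ P L A Z) (κ : Bool) : Set X := if κ then {P 0} else A

/-- When stage `j` is reached, one path is in the `j`-th bridge and the other one waits. -/
def Reached (j : ℕ) : Prop :=
  (∃ e ∈ B.hub j, ∃ a ∈ B.source (B.color j), ChainIn ρ (B.region (B.color j)) a e) ∧
    ∃ a ∈ B.source (!B.color j), ChainIn ρ (B.region (!B.color j)) a (P (B.wait j))

theorem wait_mem_locus {j : ℕ} (hj : j ≤ B.N) : B.wait j ∈ B.locus (!B.color j) :=
  ⟨j, hj, by simp, .inl rfl⟩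

/-- The singleton in `h₁` allows for points of `A` in the first hub that are outside the core; the
jump or leg taken from `c` shows that `c` is in the region. -/
theorem reached_succ (hX : IsGeodesicSpace X) {j : ℕ} (hj : j < B.N)
    (h₁ : ∀ c ∈ B.hub j, ∃ a ∈ B.source (B.color j),
      ChainIn ρ (B.region (B.color j) ∪ {c}) a c)
    (h₂ : ∃ a ∈ B.source (!B.color j), ChainIn ρ (B.region (!B.color j)) a (P (B.wait j))) :
    B.Reached (j + 1) := by
  have hρ := B.rho_pos
  by_cases hcl : B.close j
  · rw [Reached, B.color_succ_of_close hcl, B.wait_succ_of_close hcl]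
    refine ⟨⟨B.q j, (B.q_mem j hj hcl).2, ?_⟩, h₂⟩
    obtain ⟨a, ha, hch⟩ := h₁ _ (B.p_mem j hj hcl).2
    have hsub := B.jump_subset_region hj hcl
    rw [union_eq_self_of_subset_right
      (singleton_subset_iff.2 (hsub (left_mem_metricInterval _ _)))] at hch
    exact ⟨a, ha, hch.trans (.of_metricInterval_subset hX hρ hsub)⟩
  · rw [Reached, B.color_succ_of_not_close hcl, B.wait_succ_of_not_close hcl, Bool.not_not]
    constructor
    · refine ⟨B.la (j + 1), B.la_mem j hj hcl, ?_⟩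
      obtain ⟨a, ha, hch⟩ := h₂
      have hloc : uIcc (B.wait j) (B.α (j + 1)) ⊆ B.locus (!B.color j) :=
        fun t ht => ⟨j, hj.le, by simp, .inr ⟨hcl, ht⟩⟩
      have hleg := B.leg_subset_region (j := j + 1) hj (B.la_dist j hj hcl) (B.la_att j hj hcl)
        (by rw [B.color_succ_of_not_close hcl]; exact hloc right_mem_uIcc)
      rw [B.color_succ_of_not_close hcl] at hleg
      exact ⟨a, ha, (hch.trans (B.chainIn_curve hloc)).trans
        (ChainIn.of_metricInterval_subset hX hρ hleg).symm⟩
    · obtain ⟨a, ha, hch⟩ := h₁ _ (B.lb_mem j hj hcl)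
      have hloc := B.wait_mem_locus (j := j + 1) hj
      rw [B.color_succ_of_not_close hcl, B.wait_succ_of_not_close hcl, Bool.not_not] at hloc
      have hsub := B.leg_subset_region hj.le (B.lb_dist j hj hcl) (B.lb_att j hj hcl) hloc
      rw [union_eq_self_of_subset_right
        (singleton_subset_iff.2 (hsub (left_mem_metricInterval _ _)))] at hch
      exact ⟨a, ha, hch.trans (.of_metricInterval_subset hX hρ hsub)⟩

theorem reached (hX : IsGeodesicSpace X) {j : ℕ} (hj : 0 < j) (hjN : j ≤ B.N) : B.Reached j := by
  induction j, hj using Nat.le_induction with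
  | base =>
    refine B.reached_succ hX hjN (fun c hc => ?_) ⟨P 0, by simp [source, color], ?_⟩
    · obtain ⟨a, ha, hch⟩ := B.conn_first c hc
      exact ⟨a, by simpa [source, color] using ha,
        hch.mono (union_subset_union_left _ (B.core_subset_region (Nat.zero_le _)))⟩
    · exact .refl (B.curve_mem_region (B.wait_mem_locus (Nat.zero_le _)))
  | succ j hj ih =>
    obtain ⟨⟨e, he, a, ha, hch⟩, h₂⟩ := ih (by omega)
    refine B.reached_succ hX hjN (fun c hc => ⟨a, ha, ?_⟩) h₂
    exact (hch.trans ((B.conn_mid j hj hjN e he c hc).mono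
      (B.core_subset_region (by omega)))).mono subset_union_left

theorem exists_chains (hX : IsGeodesicSpace X) :
    ∃ κ, (∃ a ∈ B.source κ, ∃ z ∈ Z, ChainIn ρ (B.region κ) a z) ∧
      ∃ a ∈ B.source (!κ), ChainIn ρ (B.region (!κ)) a (P L) := by
  obtain ⟨⟨e, he, a, ha, hch⟩, a', ha', hch'⟩ := B.reached hX B.N_pos le_rfl
  refine ⟨_, ⟨a, ha, ?_⟩, a', ha', hch'.trans ?_⟩
  · obtain ⟨z, hz, h⟩ := B.conn_last e he
    exact ⟨z, hz, hch.trans (h.mono (union_subset (B.core_subset_region le_rfl)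
      (singleton_subset_iff.2 hch.mem_right)))⟩
  · have := B.chainIn_curve (κ := !B.color B.N) (s := B.wait B.N) (t := B.α (B.N + 1))
      fun t ht => ⟨B.N, le_rfl, by simp, .inr ⟨B.not_close_last, ht⟩⟩
    rwa [B.α_last] at this

/-- A chain of bridges yields two far apart paths, which use both ends of the geodesic. -/
theorem exists_paths (B : BridgeChain ρ P L A Z) (hX : IsGeodesicSpace X)
    (hA : P 0 ∈ A) (hZ : P L ∈ Z) :
    ∃ a₁ ∈ A, ∃ z₁ ∈ Z, ∃ a₂ ∈ A, ∃ z₂ ∈ Z, ∃ (P₁ : Path a₁ z₁) (P₂ : Path a₂ z₂),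
      8 * ρ ≤ setDist (range P₁) (range P₂) ∧
      P 0 ∈ ({a₁, z₁, a₂, z₂} : Set X) ∧ P L ∈ ({a₁, z₁, a₂, z₂} : Set X) := by
  obtain ⟨κ, ⟨a, ha, z, hz, h₁⟩, a', ha', h₂⟩ := B.exists_chains hX
  obtain ⟨P₁, P₂, h⟩ := exists_paths_of_chainIn (d := 8 * ρ) hX B.rho_pos h₁ h₂
    fun u hu v hv => by linarith [B.region_sep hu hv]
  have hs : ∀ κ, B.source κ ⊆ A := by
    rintro (_ | _)
    · simp [source]
    · simpa [source] using hA
  refine ⟨a, hs κ ha, z, hz, a', hs _ ha', P L, hZ, P₁, P₂, h, ?_, by simp⟩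
  cases κ
  · simp only [source, Bool.not_false, if_true, mem_singleton_iff] at ha'
    simp [ha']
  · simp only [source, if_true, mem_singleton_iff] at ha
    simp [ha]

end BridgeChain

end BridgeChains

/-! ### Bridges over a geodesic and where they touch it. -/

section Bridges

variable {X : Type*} [MetricSpace X]

theorem ChainIn.restrict {ρ : ℝ} {U : Set X} {p q : X} (h : ChainIn ρ U p q) :
    ChainIn ρ {y | ChainIn ρ U p y} p q := by
  obtain ⟨hp, h⟩ := h
  induction h with
  | refl => exact .refl (ChainIn.refl hp)
  | @tail b c _ h₂ ih =>
    have hb : ChainIn ρ U p b := ih.mem_right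
    exact ih.trans (.single hb (hb.trans (.single hb.mem_right h₂.1 h₂.2)) h₂.2)

/-- The bridges over a curve: those that contain points of `A`, those that contain points of `Z`,
and one for every point that is far away from the curve. -/
inductive Bridge (X : Type*)
  | start : Bridge X
  | finish : Bridge X
  | cls (x : X) : Bridge X

namespace Bridge

/-- The points from which a bridge emanates. -/
def seeds (A Z : Set X) : Bridge X → Set X
  | start => A
  | finish => Z
  | cls x => {x}

/-- The points of `A` or `Z` that belong to a bridge even if they are close to the curve. -/
def ends (A Z : Set X) : Bridge X → Set X
  | start => A
  | finish => Z
  | cls _ => ∅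

variable (ρ : ℝ) (P : ℝ → X) (L : ℝ) (A Z : Set X)

/-- The part of a bridge that is far away from the curve. -/
def core (i : Bridge X) : Set X :=
  {y | ∃ s ∈ seeds A Z i, ChainIn ρ (Far P L (150 * ρ)) s y}

/-- The part of a bridge that is not too close to the curve. -/
def att (i : Bridge X) : Set X := core ρ P L A Z i ∪ ends A Z i ∩ Far P L (80 * ρ)

/-- All points of a bridge. -/
def hub (i : Bridge X) : Set X := core ρ P L A Z i ∪ ends A Z i

/-- The parameters of the points of the curve that are close to a bridge. -/
def touch (i : Bridge X) : Set ℝ :=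
  {t | t ∈ Icc 0 L ∧ ∃ c ∈ hub ρ P L A Z i, dist c (P t) ≤ 150 * ρ ∧
    (c ∈ att ρ P L A Z i ∨ dist c (P t) < 80 * ρ)}

/-- The virtual parameter, beyond the ends of the curve, of the first and last bridge. -/
def virtual (L W : ℝ) : Bridge X → Set ℝ
  | start => {-W}
  | finish => {L + W}
  | cls _ => ∅

variable {ρ P L A Z}

theorem ends_subset_seeds {Y : Type*} {A Z : Set Y} (i : Bridge Y) : ends A Z i ⊆ seeds A Z i := by
  cases i <;> simp [ends, seeds]

theorem core_subset_far (i : Bridge X) : core ρ P L A Z i ⊆ Far P L (150 * ρ) := by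
  rintro y ⟨s, -, h⟩
  exact h.mem_right

theorem core_subset_att (i : Bridge X) : core ρ P L A Z i ⊆ att ρ P L A Z i :=
  subset_union_left

theorem att_subset_hub (i : Bridge X) : att ρ P L A Z i ⊆ hub ρ P L A Z i :=
  union_subset_union_right _ inter_subset_left

theorem hub_inter_far_subset_core {i : Bridge X} {y : X} (h : y ∈ hub ρ P L A Z i)
    (hy : y ∈ Far P L (150 * ρ)) : y ∈ core ρ P L A Z i := by
  rcases h with h | h
  · exact h
  · exact ⟨y, ends_subset_seeds i h, .refl hy⟩

theorem core_of_chainIn {i : Bridge X} {y y' : X} (h : y ∈ core ρ P L A Z i)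
    (h' : ChainIn ρ (Far P L (150 * ρ)) y y') : y' ∈ core ρ P L A Z i := by
  obtain ⟨s, hs, hc⟩ := h
  exact ⟨s, hs, hc.trans h'⟩

theorem exists_chainIn_core {i : Bridge X} {y : X} (h : y ∈ core ρ P L A Z i) :
    ∃ s ∈ seeds A Z i, ChainIn ρ (core ρ P L A Z i) s y := by
  obtain ⟨s, hs, hc⟩ := h
  exact ⟨s, hs, hc.restrict.mono fun y hy => ⟨s, hs, hy⟩⟩

theorem exists_chainIn_hub {i : Bridge X} {y : X} (hi : seeds A Z i = ends A Z i)
    (h : y ∈ hub ρ P L A Z i) :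
    ∃ s ∈ ends A Z i, ChainIn ρ (core ρ P L A Z i ∪ {y}) s y := by
  rcases h with h | h
  · obtain ⟨s, hs, hc⟩ := exists_chainIn_core h
    exact ⟨s, hi ▸ hs, hc.mono subset_union_left⟩
  · exact ⟨y, h, .refl (.inr rfl)⟩

theorem cls_of_ne {Y : Type*} {i : Bridge Y} (h : i ≠ start) (h' : i ≠ finish) : ∃ x, i = cls x := by
  cases i <;> simp_all

theorem exists_nearest (hL : 0 ≤ L)
    (hP : ∀ s ∈ Icc 0 L, ∀ t ∈ Icc 0 L, dist (P s) (P t) = |s - t|) (c : X) :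
    ∃ t ∈ Icc 0 L, ∀ t' ∈ Icc 0 L, dist c (P t) ≤ dist c (P t') := by
  have hc : ContinuousOn P (Icc 0 L) := continuousOn_of_dist_eq_abs_sub hP
  obtain ⟨t, ht, hmin⟩ := isCompact_Icc.exists_isMinOn (nonempty_Icc.2 hL)
    ((continuous_const (y := c)).dist continuous_id |>.comp_continuousOn hc : ContinuousOn (fun t => dist c (P t)) (Icc 0 L))
  exact ⟨t, ht, fun t' ht' => hmin ht'⟩

/-- If `c` is further than `150 * ρ` from the curve, the geodesic to its nearest point `P t` stays
in the far set until it is `150 * ρ` from `P t`, so it reaches that point within the core. -/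
theorem mem_touch_of_nearest (hX : IsGeodesicSpace X) (hρ : 0 < ρ) {i : Bridge X} {c : X}
    (hc : c ∈ hub ρ P L A Z i) {t : ℝ} (ht : t ∈ Icc 0 L)
    (hmin : ∀ t' ∈ Icc 0 L, dist c (P t) ≤ dist c (P t')) : t ∈ touch ρ P L A Z i := by
  refine ⟨ht, ?_⟩
  rcases lt_or_ge (dist c (P t)) (80 * ρ) with h₁ | h₁
  · exact ⟨c, hc, by linarith, .inr h₁⟩
  have hatt : c ∈ att ρ P L A Z i := by
    rcases hc with hc | hc
    · exact .inl hc
    · exact .inr ⟨hc, fun t' ht' => h₁.trans (hmin t' ht')⟩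
  rcases le_or_gt (dist c (P t)) (150 * ρ) with h₂ | h₂
  · exact ⟨c, hc, h₂, .inl hatt⟩
  obtain ⟨c', hc', hd⟩ := hX.exists_mem_metricInterval c (P t)
    (s := dist c (P t) - 150 * ρ) (by linarith) (by linarith)
  have hc'' : dist c c' + dist c' (P t) = dist c (P t) := hc'
  have hcore : c' ∈ core ρ P L A Z i := by
    refine core_of_chainIn (hub_inter_far_subset_core hc fun t' ht' => h₂.le.trans (hmin t' ht'))
      (.of_metricInterval_subset hX hρ fun y hy t' ht' => ?_)
    have h₃ := dist_le_of_mem_metricInterval_left hy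
    have h₄ := dist_triangle c y (P t')
    linarith [hmin t' ht']
  exact ⟨c', .inl hcore, by linarith, .inl (.inl hcore)⟩

/-- If `c` is `290 * ρ` from the curve, the geodesic to `c'` stays `150 * ρ` away and both points
share bridge `i`. Otherwise the nearest parameters differ by less than `(290 + 140 + 430) * ρ`. -/
theorem exists_near_touches (hX : IsGeodesicSpace X) (hρ : 0 < ρ) (hL : 0 ≤ L)
    (hP : ∀ s ∈ Icc 0 L, ∀ t ∈ Icc 0 L, dist (P s) (P t) = |s - t|) {i j : Bridge X} {c c' : X}
    (hc : c ∈ att ρ P L A Z i) (hc' : c' ∈ att ρ P L A Z j) (h : dist c c' < 140 * ρ) :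
    ∃ t ∈ touch ρ P L A Z i, ∃ t' ∈ touch ρ P L A Z j, |t - t'| < 860 * ρ := by
  obtain ⟨t, ht, hmin⟩ := exists_nearest hL hP c
  obtain ⟨t', ht', hmin'⟩ := exists_nearest hL hP c'
  have m' : t' ∈ touch ρ P L A Z j := mem_touch_of_nearest hX hρ (att_subset_hub j hc') ht' hmin'
  rcases le_or_gt (290 * ρ) (dist c (P t)) with h₁ | h₁
  · have hcore : c' ∈ core ρ P L A Z i := by
      refine core_of_chainIn (hub_inter_far_subset_core (att_subset_hub i hc)
        fun t' ht' => ?_) (.of_metricInterval_subset hX hρ fun y hy t' ht' => ?_)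
      · linarith [hmin t' ht']
      · have h₃ := dist_le_of_mem_metricInterval_left hy
        have h₄ := dist_triangle c y (P t')
        linarith [hmin t' ht']
    exact ⟨t', mem_touch_of_nearest hX hρ (.inl hcore) ht' hmin', t', m', by simp [hρ]⟩
  · refine ⟨t, mem_touch_of_nearest hX hρ (att_subset_hub i hc) ht hmin, t', m', ?_⟩
    rw [← hP t ht t' ht']
    have h₂ := dist_triangle4 (P t) c c' (P t')
    have h₃ := dist_triangle_left c' (P t) c
    rw [dist_comm (P t) c] at h₂
    linarith [hmin' t ht]

theorem exists_chainIn_of_mem_att {i : Bridge X} (hρ : 0 < ρ) (hi : seeds A Z i = ends A Z i)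
    {y : X} (h : y ∈ att ρ P L A Z i) : ∃ s ∈ ends A Z i, ChainIn ρ (Far P L (80 * ρ)) s y := by
  rcases h with ⟨s, hs, h⟩ | ⟨h, h'⟩
  · exact ⟨s, hi ▸ hs, h.mono (Far.anti (by linarith))⟩
  · exact ⟨y, h, .refl h'⟩

/-- A geodesic shorter than `140 * ρ` between points `80 * ρ` from the curve stays at least `10 * ρ`
from it, completing a chain that `hdir` forbids. -/
theorem start_finish_sep (hX : IsGeodesicSpace X) (hρ : 0 < ρ)
    (hdir : ∀ a ∈ A, ∀ z ∈ Z, ¬ ChainIn ρ (Far P L (9 * ρ)) a z) {c c' : X}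
    (hc : c ∈ att ρ P L A Z start) (hc' : c' ∈ att ρ P L A Z finish) : 140 * ρ ≤ dist c c' := by
  by_contra! hlt
  obtain ⟨a, ha, h₁⟩ := exists_chainIn_of_mem_att hρ rfl hc
  obtain ⟨z, hz, h₂⟩ := exists_chainIn_of_mem_att hρ rfl hc'
  have hsub : Far P L (80 * ρ) ⊆ Far P L (9 * ρ) := Far.anti (by linarith)
  refine hdir a ha z hz (((h₁.mono hsub).trans
    (.of_metricInterval_subset hX hρ fun y hy t ht => ?_)).trans (h₂.symm.mono hsub))
  have h₃ : dist c y + dist y c' = dist c c' := hy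
  have h₄ := dist_triangle c y (P t)
  have h₅ := dist_triangle_left c' (P t) y
  linarith [h₁.mem_right t ht, h₂.mem_right t ht]

/-- If no bridge crosses, a path avoiding the ball cannot pass from the left of `t₀` to the right:
near the curve the ball blocks it, and away from the curve it stays in one bridge. But `A` counts as
left and `Z` as right, through the virtual parameters. -/
theorem exists_crossing (hX : IsGeodesicSpace X) (hρ : 0 < ρ) (hL : 0 ≤ L)
    (hP : ∀ s ∈ Icc 0 L, ∀ t ∈ Icc 0 L, dist (P s) (P t) = |s - t|)
    (hdir : ∀ a ∈ A, ∀ z ∈ Z, ¬ ChainIn ρ (Far P L (9 * ρ)) a z) {t₀ : ℝ} (ht₀ : t₀ ∈ Icc 0 L)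
    (hsep : ¬ Separates (Metric.closedBall (P t₀) (1088 * ρ)) A Z) :
    ∃ i, ∃ u ∈ touch ρ P L A Z i ∪ virtual L (900 * ρ) i,
      ∃ v ∈ touch ρ P L A Z i ∪ virtual L (900 * ρ) i, u ≤ t₀ - 900 * ρ ∧ t₀ + 900 * ρ ≤ v := by
  by_contra! hno
  refine hsep fun a ha z hz hj => ?_
  have hch := ChainIn.of_joinedIn hρ hj
  have near : ∀ y ∈ (Metric.closedBall (P t₀) (1088 * ρ))ᶜ, ∀ t ∈ Icc 0 L,
      dist y (P t) < 151 * ρ → t ≤ t₀ - 900 * ρ ∨ t₀ + 900 * ρ ≤ t := by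
    intro y hy t ht hd
    rw [mem_compl_iff, Metric.mem_closedBall, not_le] at hy
    have h₁ := dist_triangle y (P t) (P t₀)
    rw [hP t ht t₀ ht₀] at h₁
    rcases le_total t t₀ with h | h
    · rw [abs_of_nonpos (by linarith)] at h₁
      exact .inl (by linarith)
    · rw [abs_of_nonneg (by linarith)] at h₁
      exact .inr (by linarith)
  have close : ∀ y y' t t', t ∈ Icc 0 L → t' ∈ Icc 0 L → dist y y' < ρ → dist y (P t) < 151 * ρ →
      dist y' (P t') < 151 * ρ → t' < t + 303 * ρ := by
    intro y y' t t' ht ht' h h₁ h₂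
    have h₃ := dist_triangle4 (P t') y' y (P t)
    rw [hP t' ht' t ht, dist_comm (P t') y', dist_comm y' y] at h₃
    linarith [le_abs_self (t' - t)]
  -- The invariant along the chain: a far point lies in a bridge reaching the left side, and any
  -- other point is near the left part of the curve.
  set left : X → Prop := fun y =>
    (y ∈ Far P L (150 * ρ) ∧ ∃ i, y ∈ core ρ P L A Z i ∧
      ∃ u ∈ touch ρ P L A Z i ∪ virtual L (900 * ρ) i, u ≤ t₀ - 900 * ρ) ∨
    ∃ t ∈ Icc 0 L, dist y (P t) < 150 * ρ ∧ t ≤ t₀ - 900 * ρ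
  have not_far : ∀ y, y ∉ Far P L (150 * ρ) → ∃ t ∈ Icc 0 L, dist y (P t) < 150 * ρ := by
    intro y hy
    by_contra! h
    exact hy h
  have start_left : ∃ u ∈ touch ρ P L A Z start ∪ virtual L (900 * ρ) (start : Bridge X),
      u ≤ t₀ - 900 * ρ := ⟨-(900 * ρ), .inr rfl, by linarith [ht₀.1]⟩
  have main : z ∈ (Metric.closedBall (P t₀) (1088 * ρ))ᶜ ∧ left z := by
    obtain ⟨haS, hch⟩ := hch
    clear hj hz
    induction hch with
    | refl =>
      refine ⟨haS, ?_⟩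
      by_cases hfar : a ∈ Far P L (150 * ρ)
      · exact .inl ⟨hfar, start, ⟨a, ha, .refl hfar⟩, start_left⟩
      · obtain ⟨t₁, ht₁, h₁⟩ := not_far a hfar
        obtain ⟨t, ht, hmin⟩ := exists_nearest hL hP a
        have hlt := (hmin t₁ ht₁).trans_lt h₁
        refine .inr ⟨t, ht, hlt, ?_⟩
        obtain ⟨u, hu, hu'⟩ := start_left
        rcases near a haS t ht (by linarith) with h | h
        · exact h
        · exact absurd h (not_le.2 (hno _ u hu t
            (.inl (mem_touch_of_nearest hX hρ (.inr ha) ht hmin)) hu'))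
    | @tail y y' _ h₂ ih =>
      obtain ⟨hyS, hy⟩ := ih
      obtain ⟨hy'S, hd⟩ := h₂
      refine ⟨hy'S, ?_⟩
      rcases hy with ⟨hfar, i, hi, u, hu, hu'⟩ | ⟨t, ht, hty, htl⟩
      · by_cases hfar' : y' ∈ Far P L (150 * ρ)
        · exact .inl ⟨hfar', i, core_of_chainIn hi (.single hfar hfar' hd), u, hu, hu'⟩
        · obtain ⟨t', ht', h'⟩ := not_far y' hfar'
          obtain ⟨t, ht, hmin⟩ := exists_nearest hL hP y
          have hty : dist y (P t) < 151 * ρ := by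
            linarith [hmin t' ht', dist_triangle y y' (P t')]
          have htl : t ≤ t₀ - 900 * ρ := by
            rcases near y hyS t ht hty with h | h
            · exact h
            · exact absurd h (not_le.2 (hno _ u hu t
                (.inl (mem_touch_of_nearest hX hρ (.inl hi) ht hmin)) hu'))
          refine .inr ⟨t', ht', h', ?_⟩
          have := close y y' t t' ht ht' hd hty (by linarith)
          rcases near y' hy'S t' ht' (by linarith) with h | h <;> linarith
      · by_cases hfar' : y' ∈ Far P L (150 * ρ)
        · obtain ⟨t', ht', hmin⟩ := exists_nearest hL hP y'
          have hty' : dist y' (P t') < 151 * ρ := by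
            linarith [hmin t ht, dist_triangle_left y' (P t) y]
          have := close y y' t t' ht ht' hd (by linarith) hty'
          have hcore : y' ∈ core ρ P L A Z (cls y') := ⟨y', rfl, .refl hfar'⟩
          refine .inl ⟨hfar', cls y', hcore, t',
            .inl (mem_touch_of_nearest hX hρ (.inl hcore) ht' hmin), ?_⟩
          rcases near y' hy'S t' ht' hty' with h | h <;> linarith
        · obtain ⟨t', ht', h'⟩ := not_far y' hfar'
          refine .inr ⟨t', ht', h', ?_⟩
          have := close y y' t t' ht ht' hd (by linarith) (by linarith)
          rcases near y' hy'S t' ht' (by linarith) with h | h <;> linarith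
  obtain ⟨hzS, hzl⟩ := main
  have finish_left : ∀ u ∈ touch ρ P L A Z finish ∪ virtual L (900 * ρ) (finish : Bridge X),
      t₀ - 900 * ρ < u := by
    intro u hu
    by_contra! h
    linarith [hno finish u hu (L + 900 * ρ) (.inr rfl) h, ht₀.2]
  rcases hzl with ⟨hfar, i, hi, u, hu, hu'⟩ | ⟨t, ht, hty, htl⟩
  · cases i with
    | start =>
      obtain ⟨a', ha', hc⟩ := hi
      exact hdir a' ha' z hz (hc.mono (Far.anti (by linarith)))
    | finish => linarith [finish_left u hu]
    | cls x =>
      replace hu : u ∈ touch ρ P L A Z (cls x) := hu.elim id fun h => h.elim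
      obtain ⟨s, hs, hsz⟩ := hi
      obtain rfl : s = x := hs
      -- A component containing `z` is part of the bridge `finish`, which does not reach the left
      -- side.
      have hsub : core ρ P L A Z (cls s) ⊆ core ρ P L A Z finish := by
        rintro y ⟨s', hs', hy⟩
        obtain rfl : s' = s := hs'
        exact ⟨z, hz, hsz.symm.trans hy⟩
      obtain ⟨htI, c, hc, hd, -⟩ := hu
      have hc' : c ∈ core ρ P L A Z finish := by
        rcases hc with hc | hc
        · exact hsub hc
        · exact hc.elim
      linarith [finish_left u (.inl ⟨htI, c, .inl hc', hd, .inl (.inl hc')⟩)]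
  · obtain ⟨t', ht', hmin⟩ := exists_nearest hL hP z
    have hlt := (hmin t ht).trans_lt hty
    have := close z z t t' ht ht' (by simpa) (by linarith) (by linarith)
    have := finish_left t' (.inl (mem_touch_of_nearest hX hρ (.inr hz) ht' hmin))
    rcases near z hzS t' ht' (by linarith) with h | h <;> linarith

end Bridge

end Bridges

/-- A sequence with the fewest steps admits no shortcut. -/
theorem exists_minimal_subsequence {step : ℕ → ℕ → Prop} {n : ℕ} (h : ∀ i < n, step i (i + 1)) :
    ∃ (N : ℕ) (k : ℕ → ℕ), k 0 = 0 ∧ k N = n ∧ (∀ j < N, step (k j) (k (j + 1))) ∧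
      ∀ j, j + 2 ≤ N → ¬ step (k j) (k (j + 2)) := by
  classical
  have hex : ∃ N, ∃ k : ℕ → ℕ, k 0 = 0 ∧ k N = n ∧ ∀ j < N, step (k j) (k (j + 1)) :=
    ⟨n, id, rfl, rfl, h⟩
  obtain ⟨k, h0, hN, hs⟩ := Nat.find_spec hex
  have hmin := fun m hm => Nat.find_min hex (m := m) hm
  generalize Nat.find hex = N at hN hs hmin
  refine ⟨N, k, h0, hN, hs, fun j hj hst => ?_⟩
  refine hmin (N - 1) (by omega) ⟨fun i => if i ≤ j then k i else k (i + 1), by simp [h0], ?_, ?_⟩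
  · beta_reduce
    rw [if_neg (by omega), Nat.sub_add_cancel (by omega), hN]
  · intro i hi
    rcases lt_trichotomy i j with hij | rfl | hij
    · simpa [hij.le, Nat.succ_le_of_lt hij] using hs i (by omega)
    · simpa using hst
    · simpa [not_le.2 hij, not_le.2 (hij.trans i.lt_succ_self)] using hs (i + 1) (by omega)

/-! ### Building the chain of bridges and choosing the constants. -/

section Assembly

variable {X : Type*} [MetricSpace X] {ρ : ℝ} {P : ℝ → X} {L : ℝ} {A Z : Set X}

open Bridge

/-- If no ball around a point of the geodesic `P` separates `A` from `Z`, and no path from `A` to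
`Z` stays far away from `P`, then there is a chain of bridges. -/
theorem exists_bridgeChain (hX : IsGeodesicSpace X) (hρ : 0 < ρ) (hL : 0 ≤ L)
    (hP : ∀ s ∈ Icc 0 L, ∀ t ∈ Icc 0 L, dist (P s) (P t) = |s - t|)
    (hdir : ∀ a ∈ A, ∀ z ∈ Z, ¬ ChainIn ρ (Far P L (9 * ρ)) a z)
    (hsep : ∀ t ∈ Icc 0 L, ¬ Separates (Metric.closedBall (P t) (1088 * ρ)) A Z) :
    Nonempty (BridgeChain ρ P L A Z) := by
  obtain ⟨n, c, a, b, hn, hc0, hcn, hcs, hcf, hab, hab', ha, hb, hgap⟩ :=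
    exists_overlapping_chain (fun i => touch ρ P L A Z i ∪ virtual L (900 * ρ) i)
      (s := start) (f := finish) (by simp) (L := L) (W := 900 * ρ) (θ := 311 * ρ) (g := 310 * ρ)
      (γ := 860 * ρ) hL (by linarith) (by linarith) (by linarith) (by linarith)
      (by
        rintro (_ | _ | x) h h'
        · exact absurd rfl h
        · exact absurd rfl h'
        · exact union_subset (fun t ht => ht.1) (empty_subset _))
      (union_subset (fun t ht => .inr ht.1) (fun t ht => .inl ht)) (.inr rfl)
      (union_subset (fun t ht => .inr ht.1) (fun t ht => .inl ht)) (.inr rfl)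
      fun t ht => exists_crossing hX hρ hL hP hdir ht (hsep t ht)
  -- The overlaps ensure that only `a 0` and `b n` can be virtual; all other feet are genuine points
  -- of contact.
  have nonneg : ∀ k, 0 < k → k ≤ n → 0 ≤ a k := by
    intro k hk hkn
    rcases (hab k hkn).1 with h | h
    · exact h.1.1
    · cases hck : c k with
      | start => exact absurd hck (hcs k hk hkn)
      | finish =>
        rw [hck] at h
        have h : a k = L + 900 * ρ := h
        linarith
      | cls x =>
        rw [hck] at h
        exact h.elim
  have hbt : ∀ k < n, b k ∈ touch ρ P L A Z (c k) := by
    intro k hk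
    rcases (hab k hk.le).2 with h | h
    · exact h
    · cases hck : c k with
      | start =>
        rw [hck] at h
        have h : b k = -(900 * ρ) := h
        linarith [hab' k hk, nonneg (k + 1) k.succ_pos hk]
      | finish => exact absurd hck (hcf k hk)
      | cls x =>
        rw [hck] at h
        exact h.elim
  have hat : ∀ k, 0 < k → k ≤ n → a k ∈ touch ρ P L A Z (c k) := by
    intro k hk hkn
    rcases (hab k hkn).1 with h | h
    · exact h
    · cases hck : c k with
      | start => exact absurd hck (hcs k hk hkn)
      | finish =>
        rw [hck] at h
        have h : a k = L + 900 * ρ := h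
        obtain ⟨k, rfl⟩ := Nat.exists_eq_succ_of_ne_zero hk.ne'
        linarith [hab' k hkn, (hbt k hkn).1.2]
      | cls x =>
        rw [hck] at h
        exact h.elim
  have a_add : ∀ i j, 0 < i → i < j → j ≤ n → a i + 310 * ρ ≤ a j := by
    intro i j hi hij
    induction j, hij using Nat.le_induction with
    | base => exact fun h => ha i hi h
    | succ j hij ih => exact fun h => by linarith [ih (by omega), ha j (by omega) (by omega)]
  have b_add : ∀ i j, i < j → j < n → b i + 310 * ρ ≤ b j := by
    intro i j hij
    induction j, hij using Nat.le_induction with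
    | base => exact fun h => hb i h
    | succ j hij ih => exact fun h => by linarith [ih (by omega), hb j h]
  have att_sep : ∀ i j, i + 3 ≤ j → j ≤ n → ∀ x ∈ att ρ P L A Z (c i), ∀ y ∈ att ρ P L A Z (c j),
      140 * ρ ≤ dist x y := by
    intro i j hij hj x hx y hy
    by_contra! hlt
    obtain ⟨t, ht, t', ht', h⟩ := exists_near_touches hX hρ hL hP hx hy hlt
    linarith [hgap i j hij hj t (.inl ht) t' (.inl ht'), neg_abs_le (t - t')]
  have att_far : ∀ k, 0 < k → k < n →
      core ρ P L A Z (c k) = hub ρ P L A Z (c k) ∧ att ρ P L A Z (c k) ⊆ Far P L (150 * ρ) ∧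
      ∃ x, c k = cls x := by
    intro k hk hkn
    obtain ⟨x, hx⟩ := cls_of_ne (hcs k hk hkn.le) (hcf k hkn)
    have : core ρ P L A Z (c k) = hub ρ P L A Z (c k) := by
      rw [hx]
      simp [hub, ends]
    exact ⟨this, fun y hy => core_subset_far _ (this ▸ att_subset_hub _ hy), x, hx⟩
  obtain ⟨N, k, hk0, hkN, hstep, hmin⟩ := exists_minimal_subsequence
    (step := fun i j => j = i + 1 ∨ (j = i + 2 ∧ ∃ x ∈ att ρ P L A Z (c i),
      ∃ y ∈ att ρ P L A Z (c j), dist x y < 60 * ρ)) (n := n) fun i _ => .inl rfl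
  have k_succ : ∀ j < N, k (j + 1) = k j + 1 ∨ k (j + 1) = k j + 2 := fun j hj =>
    (hstep j hj).imp id fun h => h.1
  have k_add : ∀ i j, i ≤ j → j ≤ N → k i + (j - i) ≤ k j := by
    intro i j hij
    induction j, hij using Nat.le_induction with
    | base => simp
    | succ j hij ih =>
      intro h
      have := ih (by omega)
      have := k_succ j (by omega)
      omega
  have k_le : ∀ j ≤ N, k j ≤ n := fun j hj => by
    have := k_add j N hj le_rfl
    omega
  have k_lt : ∀ j < N, k j < n := fun j hj => by
    have := k_add j N hj.le le_rfl
    omega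
  have k_pos : ∀ j, 0 < j → j ≤ N → 0 < k j := fun j hj hjN => by
    have := k_add 0 j hj.le hjN
    omega
  have hN : 0 < N := Nat.pos_of_ne_zero (by rintro rfl; omega)
  -- Where a bridge has been skipped no overlap is known, so such a pair must count as close.
  set cl : ℕ → Prop := fun j => j < N ∧ ((∃ x ∈ att ρ P L A Z (c (k j)),
    ∃ y ∈ att ρ P L A Z (c (k (j + 1))), dist x y < 20 * ρ) ∨ k (j + 1) = k j + 2) with hcl
  have hjump : ∀ j, cl j → ∃ x ∈ att ρ P L A Z (c (k j)), ∃ y ∈ att ρ P L A Z (c (k (j + 1))),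
      dist x y < 60 * ρ ∧ (dist x y < 20 * ρ ∨ k (j + 1) = k j + 2) := by
    rintro j ⟨hj, hj'⟩
    by_cases h : ∃ x ∈ att ρ P L A Z (c (k j)),
      ∃ y ∈ att ρ P L A Z (c (k (j + 1))), dist x y < 20 * ρ
    · obtain ⟨x, hx, y, hy, hxy⟩ := h
      exact ⟨x, hx, y, hy, by linarith, .inl hxy⟩
    · have h2 := hj'.resolve_left h
      rcases hstep j hj with h3 | ⟨-, x, hx, y, hy, hxy⟩
      · omega
      · exact ⟨x, hx, y, hy, hxy, .inr h2⟩
  have : Nonempty X := ⟨P 0⟩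
  choose! p hp q hq hpq hpq' using hjump
  have hlb : ∀ j < n, ∃ x ∈ hub ρ P L A Z (c j), dist x (P (b j)) ≤ 150 * ρ ∧
      (x ∈ att ρ P L A Z (c j) ∨ dist x (P (b j)) < 80 * ρ) := fun j hj => (hbt j hj).2
  have hla : ∀ j, 0 < j → j ≤ n → ∃ x ∈ hub ρ P L A Z (c j), dist x (P (a j)) ≤ 150 * ρ ∧
      (x ∈ att ρ P L A Z (c j) ∨ dist x (P (a j)) < 80 * ρ) := fun j hj hj' => (hat j hj hj').2
  choose! lb hlb using hlb
  choose! la hla using hla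
  have ncl : ∀ j < N, ¬ cl j → k (j + 1) = k j + 1 ∧ ∀ x ∈ att ρ P L A Z (c (k j)),
      ∀ y ∈ att ρ P L A Z (c (k (j + 1))), 20 * ρ ≤ dist x y := by
    intro j hj h
    simp only [hcl, not_and_or, not_or] at h
    obtain ⟨h1, h2⟩ := h.resolve_left (not_not.2 hj)
    push Not at h1
    exact ⟨(k_succ j hj).resolve_right h2, h1⟩
  refine ⟨{
    N := N
    core := fun j => core ρ P L A Z (c (k j))
    att := fun j => att ρ P L A Z (c (k j))
    hub := fun j => hub ρ P L A Z (c (k j))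
    close := cl
    α := fun j => if j ≤ N then a (k j) else L
    β := fun j => b (k j)
    p := p
    q := q
    la := fun j => la (k j)
    lb := fun j => lb (k j)
    N_pos := hN
    rho_pos := hρ
    L_nonneg := hL
    isom := hP
    core_subset := fun j _ => core_subset_att _
    core_far := fun j _ => core_subset_far _
    not_close_last := fun h => lt_irrefl _ h.1
    α_last := by simp
    α_mem := ?_
    β_mem := fun j hj => (hbt _ (k_lt j hj)).1
    α_add := ?_
    β_add := ?_
    α_add_le_β := ?_
    β_add_le_α := ?_
    p_mem := fun j _ h => ⟨hp j h, att_subset_hub _ (hp j h)⟩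
    q_mem := fun j _ h => ⟨hq j h, att_subset_hub _ (hq j h)⟩
    jump_lt := fun j _ h => hpq j h
    jump_far := ?_
    lb_mem := fun j hj _ => (hlb _ (k_lt j hj)).1
    lb_dist := fun j hj _ => (hlb _ (k_lt j hj)).2.1
    lb_att := fun j hj _ => (hlb _ (k_lt j hj)).2.2
    la_mem := fun j hj _ => (hla _ (k_pos _ j.succ_pos hj) (k_le _ hj)).1
    la_dist := ?_
    la_att := ?_
    sep₁ := fun j hj h => (ncl j hj h).2
    sep₂ := ?_
    sep₃ := ?_
    conn_first := ?_
    conn_mid := ?_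
    conn_last := ?_ }⟩
  · intro j hj hjN
    split_ifs with h
    · exact (hat _ (k_pos j hj h) (k_le j h)).1
    · exact ⟨hL, le_rfl⟩
  · intro i j hi hij hj
    rw [if_pos (by omega)]
    split_ifs with h
    · have := k_add i j hij.le h
      exact a_add _ _ (k_pos i hi (by omega)) (by omega) (k_le j h)
    · obtain ⟨m, hm⟩ := Nat.exists_eq_succ_of_ne_zero (k_pos i hi (by omega)).ne'
      have hmn : m < n := by have := k_le i (by omega); omega
      rw [hm]
      linarith [hab' m hmn, (hbt m hmn).1.2]
  · intro i j hij hj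
    have := k_add i j hij.le hj.le
    exact b_add _ _ (by omega) (k_lt j hj)
  · intro j hj h
    rw [if_pos (show j + 1 ≤ N from hj), (ncl j hj h).1]
    exact hab' _ (k_lt j hj)
  · intro i j hij hj
    split_ifs with h
    · have := k_add i j (by omega) h
      have := hgap (k i) (k j) (by omega) (k_le j h) (b (k i)) (.inl (hbt _ (k_lt i (by omega))))
        (a (k j)) (.inl (hat _ (k_pos j (by omega) h) (k_le j h)))
      linarith
    · have := k_add i (i + 1) (by omega) (by omega)
      have hlt := k_lt (i + 1) (by omega)
      linarith [b_add (k i) (k (i + 1)) (by omega) hlt, (hbt _ hlt).1.2]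
  · intro j hj h y hy t ht
    have h₁ : dist (p j) y + dist y (q j) = dist (p j) (q j) := hy
    have hd₁ := dist_nonneg (x := p j) (y := y)
    have hd₂ := dist_nonneg (x := y) (y := q j)
    -- A middle bridge lies entirely in the far set, so one end of the jump does unless it leads
    -- from `start` to `finish`; those are too far apart for a jump.
    by_cases h0 : 0 < k j
    · have h₂ := (att_far (k j) h0 (k_lt j hj)).2.1 (hp j h) t ht
      linarith [dist_triangle (p j) y (P t)]
    · by_cases h1 : k (j + 1) < n
      · have h₂ := (att_far (k (j + 1)) (k_pos _ j.succ_pos hj) h1).2.1 (hq j h) t ht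
        linarith [dist_triangle_left (q j) (P t) y]
      · have h₃ := hp j h
        have h₄ := hq j h
        rw [show k j = 0 by omega, hc0] at h₃
        rw [show k (j + 1) = n by have := k_le (j + 1) hj; omega, hcn] at h₄
        linarith [start_finish_sep hX hρ hdir h₃ h₄, hpq j h]
  · intro j hj _
    rw [if_pos (show j + 1 ≤ N from hj)]
    exact (hla _ (k_pos _ j.succ_pos hj) (k_le _ hj)).2.1
  · intro j hj _
    rw [if_pos (show j + 1 ≤ N from hj)]
    exact (hla _ (k_pos _ j.succ_pos hj) (k_le _ hj)).2.2
  · intro j hj x hx y hy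
    have s₁ := k_succ j (by omega)
    have s₂ : k (j + 2) = k (j + 1) + 1 ∨ k (j + 2) = k (j + 1) + 2 := k_succ (j + 1) (by omega)
    -- If nothing was skipped, minimality gives `60 * ρ` and both jumps are shorter than `20 * ρ`;
    -- otherwise `140 * ρ` accommodates jumps up to `60 * ρ`.
    by_cases h : k (j + 2) = k j + 2
    · have hno := hmin j hj
      rw [not_or, not_and] at hno
      have hno := hno.2 h
      push Not at hno
      have hd := hno x hx y hy
      refine ⟨hd, fun h' => ?_, fun h' => ?_⟩
      · have := (hpq' j h').resolve_right (by omega)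
        linarith
      · have := (hpq' (j + 1) h').resolve_right (by
          rw [show j + 1 + 1 = j + 2 from rfl]
          omega)
        linarith
    · have hd := att_sep (k j) (k (j + 2)) (by omega) (k_le _ hj) x hx y hy
      exact ⟨by linarith, fun h' => by linarith [hpq j h'], fun h' => by linarith [hpq (j + 1) h']⟩
  · intro i j hij hj
    have := k_add i j (by omega) hj
    exact att_sep _ _ (by omega) (k_le j hj)
  · intro x hx
    simp only [hk0, hc0] at hx ⊢
    exact exists_chainIn_hub rfl hx
  · intro j hj hjN x hx y hy
    obtain ⟨he, -, s, hs⟩ := att_far _ (k_pos j hj hjN.le) (k_lt j hjN)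
    simp only [← he] at hx hy
    obtain ⟨s₁, hs₁, h₁⟩ := exists_chainIn_core hx
    obtain ⟨s₂, hs₂, h₂⟩ := exists_chainIn_core hy
    have : s₁ = s₂ := by
      rw [hs] at hs₁ hs₂
      exact (show s₁ = s from hs₁).trans (show s₂ = s from hs₂).symm
    subst this
    exact h₁.symm.trans h₂
  · intro x hx
    simp only [hkN, hcn] at hx ⊢
    obtain ⟨z, hz, h⟩ := exists_chainIn_hub rfl hx
    exact ⟨z, hz, h.symm⟩

theorem exists_far_paths (hX : IsGeodesicSpace X) {K : ℝ} (hK : 0 < K)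
    (hsep : ∀ S : Set X, Bornology.IsBounded S → Metric.diam S ≤ K → ¬ Separates S A Z)
    {x z : X} (hx : x ∈ A) (hz : z ∈ Z) :
    ∃ a₁ ∈ A, ∃ z₁ ∈ Z, ∃ a₂ ∈ A, ∃ z₂ ∈ Z, ∃ (P₁ : Path a₁ z₁) (P₂ : Path a₂ z₂),
      K / 272 ≤ setDist (range P₁) (range P₂) ∧
      x ∈ ({a₁, z₁, a₂, z₂} : Set X) ∧ z ∈ ({a₁, z₁, a₂, z₂} : Set X) := by
  obtain ⟨P, h0, h1, hP⟩ := hX x z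
  have hL : 0 ≤ dist x z := dist_nonneg
  generalize dist x z = L at h1 hP hL
  subst h0 h1
  obtain ⟨ρ, rfl⟩ : ∃ ρ, K = 2176 * ρ := ⟨K / 2176, by ring⟩
  have hρ : 0 < ρ := by linarith
  rw [show 2176 * ρ / 272 = 8 * ρ by ring]
  by_cases hdir : ∀ a ∈ A, ∀ z ∈ Z, ¬ ChainIn ρ (Far P L (9 * ρ)) a z
  · obtain ⟨B⟩ := exists_bridgeChain hX hρ hL hP hdir fun t _ =>
      hsep _ Metric.isBounded_closedBall
        ((Metric.diam_closedBall (by linarith)).trans (by linarith))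
    exact B.exists_paths hX hx hz
  · push Not at hdir
    obtain ⟨a, ha, z, hz', hch⟩ := hdir
    have hc : ContinuousOn P (Icc 0 L) := continuousOn_of_dist_eq_abs_sub hP
    have hch' : ChainIn ρ (P '' Icc 0 L) (P 0) (P L) :=
      .of_isPreconnected hρ (isPreconnected_Icc.image P hc)
        (mem_image_of_mem P ⟨le_rfl, hL⟩) (mem_image_of_mem P ⟨hL, le_rfl⟩)
    obtain ⟨P₁, P₂, h⟩ := exists_paths_of_chainIn (d := 8 * ρ) hX hρ hch hch' (by
      rintro u hu _ ⟨t, ht, rfl⟩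
      linarith [hu t ht])
    exact ⟨a, ha, z, hz', P 0, hx, P L, hz, P₁, P₂, h, by simp, by simp⟩

end Assembly

theorem mainTheorem1 {X : Type*} [MetricSpace X]
    (hX : IsStandardMetricGraph X ∨ IsGeodesicSpace X)
    (A Z : Set X) (K : ℝ) (hK : 0 < K) :
    (∃ S : Set X, Bornology.IsBounded S ∧ Metric.diam S ≤ K ∧ Separates S A Z) ∨
    ((∃ a₁ ∈ A, ∃ z₁ ∈ Z, ∃ a₂ ∈ A, ∃ z₂ ∈ Z, ∃ (P₁ : Path a₁ z₁) (P₂ : Path a₂ z₂),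
        K / 272 ≤ setDist (Set.range P₁) (Set.range P₂)) ∧
      ∀ x ∈ A, ∀ z ∈ Z,
        ∃ a₁ ∈ A, ∃ z₁ ∈ Z, ∃ a₂ ∈ A, ∃ z₂ ∈ Z, ∃ (P₁ : Path a₁ z₁) (P₂ : Path a₂ z₂),
          K / 272 ≤ setDist (Set.range P₁) (Set.range P₂) ∧
          x ∈ ({a₁, z₁, a₂, z₂} : Set X) ∧ z ∈ ({a₁, z₁, a₂, z₂} : Set X)) := by
  have hX : IsGeodesicSpace X := hX.elim IsStandardMetricGraph.isGeodesicSpace id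
  by_cases hsep : ∃ S : Set X, Bornology.IsBounded S ∧ Metric.diam S ≤ K ∧ Separates S A Z
  · exact .inl hsep
  · push Not at hsep
    have key := fun x (hx : x ∈ A) z (hz : z ∈ Z) => exists_far_paths hX hK hsep hx hz
    refine .inr ⟨?_, key⟩
    -- That the empty set does not separate provides points of `A` and `Z`.
    have hne := hsep ∅ Bornology.isBounded_empty (by simpa using hK.le)
    simp only [Separates, not_forall] at hne
    obtain ⟨x, hx, z, hz, -⟩ := hne
    obtain ⟨a₁, ha₁, z₁, hz₁, a₂, ha₂, z₂, hz₂, P₁, P₂, h, -⟩ := key x hx z hz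
    exact ⟨a₁, ha₁, z₁, hz₁, a₂, ha₂, z₂, hz₂, P₁, P₂, h⟩
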